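/- Let $S^1$ be the circle of length $2\pi$, and for $p,q\in S^1$ let $\measuredangle(pq)\in[0,2\pi)$ be the length of the counterclockwise arc from $p$ to $q$. Let $S^1(4)\subset (S^1)^4$ be the space of 4-tuples $(t_1,t_2,t_3,t_4)$ of distinct points in counterclockwise cyclic order $t_1\prec t_2\prec t_3\prec t_4\prec t_1$; indices are read modulo 4. Let $S^1[4]$ be the canonical (Fulton–MacPherson–Axelrod–Singer–Kontsevich) compactification of $S^1(4)$, i.e. the closure of the graph of all the ratios $\measuredangle(t_it_j)/\measuredangle(t_it_k)\in[0,1]$ with $i\prec j\prec k\prec i$ in $(S^1)^4\times\prod[0,1]$. It is homeomorphic to $S^1\times W_4$, with $W_4$ the 3-dimensional cyclohedron, and its boundary $S^1\times\partial W_4$ is $\partial S^1[4]:=S^1[4]\setminus S^1(4)$. The group $\mathbb{Z}/4$ acts on $S^1[4]$ and on $\partial S^1[4]$ by cyclic relabelling, and on $\mathbb{R}^4=\mathbb{R}^3\oplus\mathbb{R}$ through the generator acting as $-1$. For a $C^1$ embedding $\varphi:S^1\to\mathbb{R}^3$ (injective, $C^1$, with nowhere vanishing derivative) put $x_i=\varphi(t_i)$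 and $$F_\varphi(t)=\bigl(x_1-x_2+x_3-x_4,\ \|x_1-x_2\|-\|x_2-x_3\|+\|x_3-x_4\|-\|x_4-x_1\|\bigr)\in\mathbb{R}^3\oplus\mathbb{R},$$ and let $\eta(t)$ be the least length of a closed arc of $S^1$ containing $t_1,\dots,t_4$. Then: 1. For every $C^1$ embedding $\varphi$, the map $\eta^{-1}F_\varphi:S^1(4)\to\mathbb{R}^4$ has a unique continuous extension $\tilde F_\varphi:S^1[4]\to\mathbb{R}^4$. It is $\mathbb{Z}/4$-equivariant and has no zeros on $\partial S^1[4]=S^1\times\partial W_4$. 2. For any two $C^1$ embeddings $\varphi,\psi:S^1\to\mathbb{R}^3$ the restrictions $\tilde F_\varphi^\partial,\tilde F_\psi^\partial:\partial S^1[4]\to\mathbb{R}^4\setminus\{0\}$ are $\mathbb{Z}/4$-equivariantly homotopic. So the equivariant homotopy class depends neither on the curve (or its knot type) nor on its parametrization. The same two assertions hold if $S^1[4]$ is replaced by the coarser compactification of $S^1(4)$, the closure of the graph of only the four consecutive ratios $\theta_i=\measuredangle(t_{i-1}t_i)/\measuredangle(t_{i-1}t_{i+1})$ (with boundary again the complement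 of $S^1(4)$). -/

import Mathlib

namespace RhombusPeg

/-- The unit circle, parametrized by arc length (angle modulo `2π`), counterclockwise. -/
abbrev S1 : Type := AddCircle (2 * Real.pi)

/-- Euclidean 3-space. -/
abbrev E3 : Type := EuclideanSpace ℝ (Fin 3)

/-- The test space `ℝ⁴ = U₁ ⊕ U₂`, with `U₁ = ℝ³` and `U₂ = ℝ`. -/
abbrev TestSpace : Type := E3 × ℝ

/-- Length in `[0, 2π)` of the counterclockwise arc of the circle from `p` to `q`. -/
noncomputable def arc (p q : S1) : ℝ :=
  haveI : Fact (0 < 2 * Real.pi) := ⟨Real.two_pi_pos⟩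
  (AddCircle.equivIco (2 * Real.pi) 0 (q - p) : ℝ)

/-- The configuration space `S¹(4)` of labelled, cyclically ordered 4-tuples of distinct points of
the circle. Labels are taken modulo 4; the counterclockwise cyclic order is expressed by saying that
the counterclockwise path `q₀ → q₁ → q₂ → q₃ → q₀` winds exactly once around the circle. -/
def config : Set (ZMod 4 → S1) :=
  {q | Function.Injective q ∧ ∑ i, arc (q i) (q (i + 1)) = 2 * Real.pi}

/-- The ratio `∡(qᵢ qᵢ₊ₐ) / ∡(qᵢ qᵢ₊ᵦ)` of arc lengths, for `p = (a, b)`. For `1 ≤ a < b ≤ 3` and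
`q` in `S¹(4)` it lies in `[0, 1]`. -/
noncomputable def ratio (q : ZMod 4 → S1) (i : ZMod 4) (p : ℕ × ℕ) : ℝ :=
  arc (q i) (q (i + (p.1 : ZMod 4))) / arc (q i) (q (i + (p.2 : ZMod 4)))

/-- The family of the four ratios `θᵢ = ∡(qᵢ₋₁ qᵢ) / ∡(qᵢ₋₁ qᵢ₊₁)` of consecutive points. -/
def consecutiveRatios : Set (ℕ × ℕ) := {(1, 2)}

/-- The family of all twelve ratios `∡(qᵢ qⱼ) / ∡(qᵢ qₖ)` with `i ≺ j ≺ k ≺ i` in cyclic order. -/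
def allRatios : Set (ℕ × ℕ) := {(1, 2), (1, 3), (2, 3)}

/-- The space that contains the compactification. -/
abbrev Ambient (R : Set (ℕ × ℕ)) : Type := (ZMod 4 → S1) × (ZMod 4 → R → ℝ)

/-- The diagonal map that sends `q` to `q` together with all its ratios from the family `R`. -/
noncomputable def graphMap (R : Set (ℕ × ℕ)) (q : ZMod 4 → S1) : Ambient R :=
  (q, fun i p => ratio q i p)

/-- The compactification of `S¹(4)` by the ratios from the family `R`: the closure of the image of
`S¹(4)` under the diagonal map. As the ratios in question take values in `[0, 1]` on `S¹(4)`,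
the closure in `(S¹)⁴ × ∏ ℝ` is the same as the closure in `Cl(S¹(4)) × ∏ [0, 1]`.

For `R = allRatios` this is the canonical (Fulton-MacPherson, Axelrod-Singer, Kontsevich)
compactification `S¹[4] ≅ S¹ × W₄`, with `W₄` the 3-dimensional cyclohedron; for
`R = consecutiveRatios` it is the coarser compactification by the functions `θᵢ` alone. -/
noncomputable def compactConfig (R : Set (ℕ × ℕ)) : Set (Ambient R) :=
  closure (graphMap R '' config)

/-- The boundary `S¹[4] \ S¹(4)` of the compactification; it is `S¹ × ∂W₄` for `allRatios`. -/
noncomputable def boundary (R : Set (ℕ × ℕ)) : Set (Ambient R) :=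
  compactConfig R \ (graphMap R '' config)

theorem graphMap_mem (R : Set (ℕ × ℕ)) {q : ZMod 4 → S1} (hq : q ∈ config) :
    graphMap R q ∈ compactConfig R :=
  subset_closure ⟨q, hq, rfl⟩

/-- Cyclic relabelling by `k ∈ ℤ/4`. -/
def shift {R : Set (ℕ × ℕ)} (k : ZMod 4) (x : Ambient R) : Ambient R :=
  (fun i => x.1 (i + k), fun i => x.2 (i + k))

theorem shift_zero {R : Set (ℕ × ℕ)} (x : Ambient R) : shift 0 x = x := by
  simp [shift]

theorem shift_add {R : Set (ℕ × ℕ)} (k l : ZMod 4) (x : Ambient R) :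
    shift (k + l) x = shift k (shift l x) := by
  simp [shift, add_assoc]

theorem shift_mem_config (k : ZMod 4) {q : ZMod 4 → S1} (hq : q ∈ config) :
    (fun i => q (i + k)) ∈ config := by
  refine ⟨fun i j h => add_right_cancel (hq.1 h), ?_⟩
  rw [← hq.2, ← Equiv.sum_comp (Equiv.addRight k) (fun i => arc (q i) (q (i + 1)))]
  simp [add_right_comm]

theorem shift_graphMap (R : Set (ℕ × ℕ)) (k : ZMod 4) (q : ZMod 4 → S1) :
    shift k (graphMap R q) = graphMap R (fun i => q (i + k)) := by
  simp only [shift, graphMap, Prod.mk.injEq, true_and]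
  funext i p
  simp only [ratio, add_right_comm]

theorem shift_mem_image {R : Set (ℕ × ℕ)} (k : ZMod 4) {x : Ambient R}
    (hx : x ∈ graphMap R '' config) : shift k x ∈ graphMap R '' config := by
  obtain ⟨q, hq, rfl⟩ := hx
  exact ⟨_, shift_mem_config k hq, (shift_graphMap R k q).symm⟩

theorem shift_mem {R : Set (ℕ × ℕ)} (k : ZMod 4) {x : Ambient R} (hx : x ∈ compactConfig R) :
    shift k x ∈ compactConfig R := by
  have hc : Continuous (shift (R := R) k) := by unfold shift; fun_prop
  exact map_mem_closure hc hx fun _ hy => shift_mem_image k hy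

theorem shift_mem_boundary {R : Set (ℕ × ℕ)} (k : ZMod 4) {x : Ambient R} (hx : x ∈ boundary R) :
    shift k x ∈ boundary R := by
  refine ⟨shift_mem k hx.1, fun h => hx.2 ?_⟩
  have := shift_mem_image (-k) h
  rwa [← shift_add, neg_add_cancel, shift_zero] at this

/-- The action of `ℤ/4` on the compactification by cyclic permutations. -/
instance (R : Set (ℕ × ℕ)) : AddAction (ZMod 4) (compactConfig R) where
  vadd k x := ⟨shift k x, shift_mem k x.2⟩
  zero_vadd x := Subtype.ext (shift_zero (x : Ambient R))
  add_vadd k l x := Subtype.ext (shift_add k l (x : Ambient R))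

/-- The action of `ℤ/4` on the boundary of the compactification. -/
instance (R : Set (ℕ × ℕ)) : AddAction (ZMod 4) (boundary R) where
  vadd k x := ⟨shift k x, shift_mem_boundary k x.2⟩
  zero_vadd x := Subtype.ext (shift_zero (x : Ambient R))
  add_vadd k l x := Subtype.ext (shift_add k l (x : Ambient R))

/-- A `C¹` embedding of the circle in 3-space: injective, continuously differentiable,
with nowhere vanishing derivative. -/
structure IsC1Embedding (φ : S1 → E3) : Prop where
  injective : Function.Injective φ
  contDiff : ContDiff ℝ 1 (fun s : ℝ => φ (s : S1))
  deriv_ne_zero : ∀ s : ℝ, deriv (fun s : ℝ => φ (s : S1)) s ≠ 0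

/-- The map `Ψ = (Ψ₁, Ψ₂)` whose zeros are the quadruples of consecutive vertices of rhombi. -/
noncomputable def rhombusTest (x : ZMod 4 → E3) : TestSpace :=
  (x 0 - x 1 + x 2 - x 3, ‖x 0 - x 1‖ - ‖x 1 - x 2‖ + ‖x 2 - x 3‖ - ‖x 3 - x 0‖)

/-- The rhombus test map `F_φ(t) = Ψ(φ(t₀), φ(t₁), φ(t₂), φ(t₃))` of a curve `φ`. -/
noncomputable def testMap (φ : S1 → E3) (t : ZMod 4 → S1) : TestSpace :=
  rhombusTest (fun i => φ (t i))

/-- The arc-length diameter of `{t₀, t₁, t₂, t₃}`: the least length `l` of a closed arc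
(starting at some point `a`, and running counterclockwise) which contains all points `tᵢ`. -/
noncomputable def arcDiam (t : ZMod 4 → S1) : ℝ :=
  sInf {l : ℝ | ∃ a : S1, ∀ i, arc a (t i) ≤ l}

/-- `F` is a continuous extension to `S¹[4]` of the rescaled test map `η⁻¹ · F_φ` on `S¹(4)`. -/
def IsExtension {R : Set (ℕ × ℕ)} (φ : S1 → E3) (F : C(compactConfig R, TestSpace)) : Prop :=
  ∀ (t : ZMod 4 → S1) (ht : t ∈ config),
    F ⟨graphMap R t, graphMap_mem R ht⟩ = (arcDiam t)⁻¹ • testMap φ t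

/-- `f` is `ℤ/4`-equivariant, where the generator of `ℤ/4` acts on `U₁ ⊕ U₂` by `-1`. -/
def IsEquivariant {X : Type*} [VAdd (ZMod 4) X] (f : X → TestSpace) : Prop :=
  ∀ (k : ZMod 4) (x : X), f (k +ᵥ x) = (-1 : ℝ) ^ k.val • f x

/-- The restriction `S¹ × ∂W₄ → ℝ⁴ \ {0}` to the boundary of a map on `S¹[4]` that has no zeros
there. -/
noncomputable def boundaryMap {R : Set (ℕ × ℕ)} (F : C(compactConfig R, TestSpace))
    (hF : ∀ x : compactConfig R, (x : Ambient R) ∈ boundary R → F x ≠ 0) :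
    C(boundary R, {u : TestSpace // u ≠ 0}) where
  toFun x := ⟨F ⟨x, x.2.1⟩, hF _ x.2⟩
  continuous_toFun := by fun_prop

end RhombusPeg

open Filter Topology Set Real
open scoped unitInterval

namespace RhombusPeg

/-! The rescaled test map is an alternating sum over the four consecutive chords: each term is the
arc distance of the end points divided by the diameter `η`, times a function `v` of the chord. Here
`v` is the pair of `-1/2` times the difference quotient of the curve and the norm of that quotient.
For a `C¹` curve `v` is continuous up to the degenerate chords `g = 0` and `g = 2π`, so only the
scalar weights can misbehave at the boundary.

Along an ultrafilter all gaps and weights converge. Unless all points collapse, the limit points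
determine these limits. In a collapse one gap `k` tends to `2π`, and the limit depends only on the
weight of the opposite gap `k + 2`, which the consecutive ratios determine (`limitSum_unique`). This
gives the extension (`exists_extension`) for both compactifications.

At a boundary point some gap vanishes. In a collapse with opposite weight `c`, the two components
are nonzero multiples of `1 - c` and `c`. Otherwise three chords form a closed triangle with
alternating signs. Such a triangle is harmless in two cases: if the directions are true chords of an
injective curve and the lengths are positive (`admissible_of_injective`), or if the lengths are
those of the round circle and the directions form any nowhere zero field odd under reversal
(`admissible_roundLength`).

The homotopy passes from the first case to the second. The lengths are deformed linearly to the
round ones with the directions fixed; then every chord is deformed to a half circle with the same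
midpoint, leaving an odd loop in `ℝ³ \ {0}`. A generic trigonometric loop is nowhere parallel to the
loops of either curve (`exists_trigonometric_loop`), so both are linearly homotopic to it. -/

instance : Fact (0 < 2 * π) := ⟨Real.two_pi_pos⟩

/-! ### Arcs of the circle -/

theorem arc_nonneg (p q : S1) : 0 ≤ arc p q :=
  (AddCircle.equivIco (2 * π) 0 (q - p)).2.1

theorem arc_lt (p q : S1) : arc p q < 2 * π := by
  exact (AddCircle.equivIco (2 * π) 0 (q - p)).2.2.trans_eq (zero_add _)

theorem coe_arc (p q : S1) : ((arc p q : ℝ) : S1) = q - p :=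
  AddCircle.coe_equivIco

theorem add_arc (p q : S1) : p + ((arc p q : ℝ) : S1) = q := by
  rw [coe_arc, add_sub_cancel]

theorem coe_eq_coe_imp {r s : ℝ} (hr : 0 ≤ r) (hr' : r < 2 * π) (hs : 0 ≤ s) (hs' : s < 2 * π)
    (h : (r : S1) = s) : r = s := by
  have h1 := AddCircle.equivIco_coe_of_mem (p := 2 * π) (a := 0) (y := r) ⟨hr, by simpa using hr'⟩
  have h2 := AddCircle.equivIco_coe_of_mem (p := 2 * π) (a := 0) (y := s) ⟨hs, by simpa using hs'⟩
  rw [← h1, ← h2, h]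

theorem arc_eq {p q : S1} {r : ℝ} (h0 : 0 ≤ r) (h1 : r < 2 * π) (h : p + (r : S1) = q) :
    arc p q = r := by
  refine coe_eq_coe_imp (arc_nonneg _ _) (arc_lt _ _) h0 h1 ?_
  rw [coe_arc, ← h, add_sub_cancel_left]

theorem arc_self (p : S1) : arc p p = 0 :=
  arc_eq le_rfl Real.two_pi_pos (by simp)

theorem arc_eq_zero {p q : S1} : arc p q = 0 ↔ p = q := by
  refine ⟨fun h => ?_, fun h => h ▸ arc_self p⟩
  have := add_arc p q
  simpa [h] using this

theorem coe_two_pi : ((2 * π : ℝ) : S1) = 0 := AddCircle.coe_period _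

theorem continuousAt_arc {p q : S1} (h : p ≠ q) :
    ContinuousAt (fun x : S1 × S1 => arc x.1 x.2) (p, q) := by
  have h1 : ContinuousAt (AddCircle.equivIco (2 * π) 0) (q - p) :=
    AddCircle.continuousAt_equivIco _ _ (by simpa [sub_eq_zero] using h.symm)
  have h2 : ContinuousAt (fun x : S1 × S1 => x.2 - x.1) (p, q) := by fun_prop
  exact continuousAt_subtype_val.comp
    (ContinuousAt.comp (f := fun x : S1 × S1 => x.2 - x.1) (x := (p, q)) h1 h2)

/-! ### Signs and cyclic sums over `ℤ/4` -/

/-- The sign character of `ℤ/4`. -/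
noncomputable def sgn (i : ZMod 4) : ℝ := (-1) ^ i.val

theorem sgn_add (i j : ZMod 4) : sgn (i + j) = sgn i * sgn j := by
  rw [sgn, sgn, sgn, ← pow_add]
  -- Reduction modulo 4 preserves parity.
  have : ∀ i j : ZMod 4, (i + j).val % 2 = (i.val + j.val) % 2 := by decide
  rw [neg_one_pow_eq_pow_mod_two, this, ← neg_one_pow_eq_pow_mod_two]

theorem sgn_zero : sgn 0 = 1 := by simp [sgn]

theorem sgn_one : sgn 1 = -1 := by
  have : (1 : ZMod 4).val = 1 := rfl
  simp [sgn, this]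

theorem sgn_two : sgn 2 = 1 := by
  rw [show (2 : ZMod 4) = 1 + 1 from rfl, sgn_add, sgn_one]; norm_num

theorem sgn_three : sgn 3 = -1 := by
  rw [show (3 : ZMod 4) = 2 + 1 from rfl, sgn_add, sgn_one, sgn_two]; norm_num

theorem sgn_ne_zero (i : ZMod 4) : sgn i ≠ 0 := pow_ne_zero _ (by norm_num)

theorem sum_cyclic {M : Type*} [AddCommMonoid M] (f : ZMod 4 → M) (k : ZMod 4) :
    ∑ i, f i = f k + f (k + 1) + f (k + 2) + f (k + 3) := by
  rw [← Equiv.sum_comp (Equiv.addLeft k) f]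
  refine (Fin.sum_univ_four (fun i : Fin 4 => f (k + (show ZMod 4 from i)))).trans ?_
  have : f (k + (0 : ZMod 4)) = f k := by rw [add_zero]
  exact congrArg (· + f (k + 1) + f (k + 2) + f (k + 3)) this

theorem sum_sgn_smul {M : Type*} [AddCommGroup M] [Module ℝ M] (f : ZMod 4 → M) (k : ZMod 4) :
    ∑ i, sgn i • f i = sgn k • (f k - f (k + 1) + f (k + 2) - f (k + 3)) := by
  rw [sum_cyclic _ k]
  simp only [sgn_add, sgn_one, sgn_two, sgn_three]
  module

theorem eq_of_cyclic (k i : ZMod 4) : i = k ∨ i = k + 1 ∨ i = k + 2 ∨ i = k + 3 := by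
  revert k i; decide

theorem forall_cyclic {P : ZMod 4 → Prop} (k : ZMod 4) (h0 : P k) (h1 : P (k + 1))
    (h2 : P (k + 2)) (h3 : P (k + 3)) (i : ZMod 4) : P i := by
  rcases eq_of_cyclic k i with rfl | rfl | rfl | rfl <;> assumption

/-! ### Gaps and the arc-length diameter -/

/-- The length of the arc between two consecutive points. -/
noncomputable def gap (t : ZMod 4 → S1) (i : ZMod 4) : ℝ := arc (t i) (t (i + 1))

/-- The distance to the end points of `[0, 2π]`. -/
noncomputable def fold (g : ℝ) : ℝ := min g (2 * π - g)

/-- The arc-length diameter in terms of the gaps. -/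
noncomputable def gapDiam (g : ZMod 4 → ℝ) : ℝ := 2 * π - Finset.univ.sup' Finset.univ_nonempty g

theorem continuous_fold : Continuous fold := by unfold fold; fun_prop

theorem continuous_gapDiam : Continuous gapDiam := by
  unfold gapDiam
  refine continuous_const.sub (Continuous.finset_sup'_apply _ fun i _ => continuous_apply i)

theorem gapDiam_le (g : ZMod 4 → ℝ) (i : ZMod 4) : gapDiam g ≤ 2 * π - g i :=
  sub_le_sub_left (Finset.le_sup' g (Finset.mem_univ i)) _

theorem exists_gapDiam_eq (g : ZMod 4 → ℝ) : ∃ k, gapDiam g = 2 * π - g k ∧ ∀ i, g i ≤ g k := by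
  obtain ⟨k, -, hk⟩ := Finset.exists_mem_eq_sup' Finset.univ_nonempty g
  exact ⟨k, by rw [gapDiam, hk], fun i => hk ▸ Finset.le_sup' g (Finset.mem_univ i)⟩

theorem gapDiam_eq {g : ZMod 4 → ℝ} {k : ZMod 4} (h : ∀ i, g i ≤ g k) :
    gapDiam g = 2 * π - g k := by
  obtain ⟨j, hj, hj'⟩ := exists_gapDiam_eq g
  rw [hj, le_antisymm (hj' k) (h j)]

/-- The diameter is the complement of a largest gap `k`. That complement bounds the fold of `g k` by
definition, and it contains every other gap. -/
theorem fold_le_gapDiam {g : ZMod 4 → ℝ} (h0 : ∀ i, 0 ≤ g i) (hs : ∑ i, g i = 2 * π)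
    (i : ZMod 4) : fold (g i) ≤ gapDiam g := by
  obtain ⟨k, hk, -⟩ := exists_gapDiam_eq g
  rw [hk, fold]
  rw [sum_cyclic g k] at hs
  have h1 := h0 (k + 1)
  have h2 := h0 (k + 2)
  have h3 := h0 (k + 3)
  rcases eq_of_cyclic k i with rfl | rfl | rfl | rfl
  · exact min_le_right _ _
  all_goals exact (min_le_left _ _).trans (by linarith)

theorem fold_nonneg {g : ℝ} (h0 : 0 ≤ g) (h1 : g ≤ 2 * π) : 0 ≤ fold g :=
  le_min h0 (by linarith)

theorem fold_pos {g : ℝ} (h0 : 0 < g) (h1 : g < 2 * π) : 0 < fold g :=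
  lt_min h0 (by linarith)

theorem fold_symm (g : ℝ) : fold (2 * π - g) = fold g := by
  rw [fold, fold, sub_sub_cancel, min_comm]

theorem fold_zero : fold 0 = 0 := by
  rw [fold, sub_zero, min_eq_left Real.two_pi_pos.le]

theorem gap_nonneg (t : ZMod 4 → S1) (i : ZMod 4) : 0 ≤ gap t i := arc_nonneg _ _

theorem gap_lt (t : ZMod 4 → S1) (i : ZMod 4) : gap t i < 2 * π := arc_lt _ _

theorem add_gap (t : ZMod 4 → S1) (i : ZMod 4) : t i + ((gap t i : ℝ) : S1) = t (i + 1) :=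
  add_arc _ _

section Config

variable {t : ZMod 4 → S1} (ht : t ∈ config)

include ht

theorem gap_pos (i : ZMod 4) : 0 < gap t i := by
  refine lt_of_le_of_ne (gap_nonneg t i) fun h => ?_
  have h1 : ∀ i : ZMod 4, i ≠ i + 1 := by decide
  exact h1 i (ht.1 (arc_eq_zero.1 h.symm))

theorem sum_gap : ∑ i, gap t i = 2 * π := ht.2

theorem gap_cyclic (k : ZMod 4) :
    gap t k + gap t (k + 1) + gap t (k + 2) + gap t (k + 3) = 2 * π := by
  rw [← sum_cyclic, sum_gap ht]

theorem arc_add_two (i : ZMod 4) : arc (t i) (t (i + 2)) = gap t i + gap t (i + 1) := by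
  have h := gap_cyclic ht i
  have h2 := gap_pos ht (i + 2)
  have h3 := gap_pos ht (i + 3)
  have h0 := gap_pos ht i
  have h1 := gap_pos ht (i + 1)
  refine arc_eq (by linarith) (by linarith) ?_
  rw [AddCircle.coe_add, ← add_assoc, add_gap, add_gap]
  congr 1; ring

/-- The form without a quotient passes to limits in which both gaps vanish. -/
theorem ratio_one_two (i : ZMod 4) :
    ratio t i (1, 2) * (gap t i + gap t (i + 1)) = gap t i := by
  have h0 := gap_pos ht i
  have h1 := gap_pos ht (i + 1)
  have : ratio t i (1, 2) = gap t i / (gap t i + gap t (i + 1)) := by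
    simp only [ratio, Nat.cast_one, Nat.cast_ofNat, arc_add_two ht]
    rfl
  rw [this]
  field_simp

omit ht in
theorem gapDiam_pos : 0 < gapDiam (gap t) := by
  obtain ⟨k, hk, -⟩ := exists_gapDiam_eq (gap t)
  rw [hk]
  linarith [gap_lt t k]

end Config

theorem arcDiam_eq {t : ZMod 4 → S1} (ht : t ∈ config) : arcDiam t = gapDiam (gap t) := by
  refine IsLeast.csInf_eq ⟨?_, ?_⟩
  · obtain ⟨k, hk, -⟩ := exists_gapDiam_eq (gap t)
    rw [hk]
    have hs := gap_cyclic ht k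
    have p0 := gap_pos ht k
    have p1 := gap_pos ht (k + 1)
    have p2 := gap_pos ht (k + 2)
    have p3 := gap_pos ht (k + 3)
    have e1 : t (k + 1) + ((gap t (k + 1) : ℝ) : S1) = t (k + 2) := by
      rw [add_gap]; congr 1; ring
    have e2 : t (k + 2) + ((gap t (k + 2) : ℝ) : S1) = t (k + 3) := by
      rw [add_gap]; congr 1; ring
    have e3 : t (k + 3) + ((gap t (k + 3) : ℝ) : S1) = t k := by
      rw [add_gap, add_assoc]; congr 1
      have : (3 + 1 : ZMod 4) = 0 := rfl
      rw [this, add_zero]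
    -- The optimal arc is the complement of the largest gap, so it starts where that gap ends.
    refine ⟨t (k + 1), forall_cyclic k ?_ ?_ ?_ ?_⟩
    · rw [arc_eq (r := gap t (k + 1) + gap t (k + 2) + gap t (k + 3)) (by linarith) (by linarith)]
      · linarith
      · rw [AddCircle.coe_add, AddCircle.coe_add, ← add_assoc, ← add_assoc, e1, e2, e3]
    · rw [arc_self]; linarith
    · exact by
        rw [arc_eq (r := gap t (k + 1)) p1.le (by linarith) e1]; linarith
    · rw [arc_eq (r := gap t (k + 1) + gap t (k + 2)) (by linarith) (by linarith)]
      · linarith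
      · rw [AddCircle.coe_add, ← add_assoc, e1, e2]
  · rintro l ⟨a, ha⟩
    by_contra! hl
    -- If a shorter arc sufficed, no step from `t i` to `t (i + 1)` could pass `a`. The positions
    -- would then increase all the way around, although they return to their start.
    have key : ∀ i, arc a (t (i + 1)) = arc a (t i) + gap t i := by
      intro i
      have h1 := gapDiam_le (gap t) i
      have h2 := ha i
      refine arc_eq (add_nonneg (arc_nonneg _ _) (gap_nonneg _ _)) (by linarith) ?_
      rw [AddCircle.coe_add, ← add_assoc, add_arc, add_gap]
    have hs : ∑ i, arc a (t (i + 1)) = ∑ i, arc a (t i) :=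
      Equiv.sum_comp (Equiv.addRight 1) fun i => arc a (t i)
    rw [Finset.sum_congr rfl fun i _ => key i, Finset.sum_add_distrib, sum_gap ht] at hs
    linarith [Real.two_pi_pos]

/-! ### Chord sums and the uniqueness of their limits -/

variable {V : Type*} [NormedAddCommGroup V] [NormedSpace ℝ V]

/-- The rescaled alternating sum over the four consecutive pairs of points of the values of a
function `fold g • v p g` of the chord from `p` to `p + g`. -/
noncomputable def chordSum (v : S1 → ℝ → V) (t : ZMod 4 → S1) : V :=
  ∑ i, sgn i • (fold (gap t i) / gapDiam (gap t)) • v (t i) (gap t i)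

/-- The limit of a rescaled alternating sum in terms of the limits `x` of the points, `g` of the
gaps and `c` of the rescaled folded gaps. -/
noncomputable def limitSum (v : S1 → ℝ → V) (x : ZMod 4 → S1) (g c : ZMod 4 → ℝ) : V :=
  ∑ i, sgn i • c i • v (x i) (g i)

/-- The relations between the limits `x` of the points, `θ` of the ratios, `g` of the gaps and `c`
of the rescaled folded gaps of a convergent family of configurations. -/
structure IsLimitData (x : ZMod 4 → S1) (θ g c : ZMod 4 → ℝ) : Prop where
  nonneg : ∀ i, 0 ≤ g i
  sum_eq : ∑ i, g i = 2 * π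
  step : ∀ i, x i + ((g i : ℝ) : S1) = x (i + 1)
  regular : (∀ i, g i < 2 * π) → ∀ i, c i = fold (g i) / gapDiam g
  scale_nonneg : ∀ i, 0 ≤ c i
  scale : ∀ k, g k = 2 * π → c k = 1 ∧ c (k + 1) + c (k + 2) + c (k + 3) = 1
  ratio_top : ∀ k, g k = 2 * π → θ k = 1 ∧ θ (k + 3) = 0
  ratio_mid : ∀ k, g k = 2 * π → θ (k + 1) * (c (k + 1) + c (k + 2)) = c (k + 1) ∧
    θ (k + 2) * (c (k + 2) + c (k + 3)) = c (k + 2)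

theorem IsLimitData.cyclic {x : ZMod 4 → S1} {θ g c : ZMod 4 → ℝ} (h : IsLimitData x θ g c)
    (k : ZMod 4) : g k + g (k + 1) + g (k + 2) + g (k + 3) = 2 * π := by
  rw [← sum_cyclic, h.sum_eq]

theorem IsLimitData.le {x : ZMod 4 → S1} {θ g c : ZMod 4 → ℝ} (h : IsLimitData x θ g c)
    (k : ZMod 4) : g k ≤ 2 * π := by
  linarith [h.cyclic k, h.nonneg (k + 1), h.nonneg (k + 2), h.nonneg (k + 3)]

theorem IsLimitData.eq_zero {x : ZMod 4 → S1} {θ g c : ZMod 4 → ℝ} (h : IsLimitData x θ g c)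
    {k : ZMod 4} (hk : g k = 2 * π) : g (k + 1) = 0 ∧ g (k + 2) = 0 ∧ g (k + 3) = 0 := by
  have := h.cyclic k
  have h1 := h.nonneg (k + 1)
  have h2 := h.nonneg (k + 2)
  have h3 := h.nonneg (k + 3)
  exact ⟨by linarith, by linarith, by linarith⟩

theorem IsLimitData.const {x : ZMod 4 → S1} {θ g c : ZMod 4 → ℝ} (h : IsLimitData x θ g c)
    {k : ZMod 4} (hk : g k = 2 * π) (i j : ZMod 4) : x i = x j := by
  have key : ∀ i, x i = x (i + 1) := by
    obtain ⟨h1, h2, h3⟩ := h.eq_zero hk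
    refine forall_cyclic k ?_ ?_ ?_ ?_
    · rw [← h.step k, hk, coe_two_pi, add_zero]
    · rw [← h.step (k + 1), h1, AddCircle.coe_zero, add_zero]
    · rw [← h.step (k + 2), h2, AddCircle.coe_zero, add_zero]
    · rw [← h.step (k + 3), h3, AddCircle.coe_zero, add_zero]
  have key' : ∀ i, x i = x 0 := by
    have e1 := key 0
    have e2 := key 1
    have e3 := key 2
    rw [zero_add] at e1
    rw [show (1 + 1 : ZMod 4) = 2 from rfl] at e2
    rw [show (2 + 1 : ZMod 4) = 3 from rfl] at e3
    refine forall_cyclic 0 rfl ?_ ?_ ?_ <;> simp only [zero_add] <;> simp only [e1, e2, e3]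
  rw [key' i, key' j]

theorem IsLimitData.exists_ne {x : ZMod 4 → S1} {θ g c : ZMod 4 → ℝ} (h : IsLimitData x θ g c)
    (hg : ∀ i, g i < 2 * π) : ∃ i, x i ≠ x (i + 1) := by
  by_contra! hx
  have : ∀ i, g i = 0 := fun i => by
    have := h.step i
    rw [← hx i, add_eq_left] at this
    exact coe_eq_coe_imp (h.nonneg i) (hg i) le_rfl Real.two_pi_pos (by simpa using this)
  have hs := h.sum_eq
  simp only [this, Finset.sum_const_zero] at hs
  exact Real.two_pi_pos.ne hs

theorem IsLimitData.gap_eq {x : ZMod 4 → S1} {θ g c : ZMod 4 → ℝ} (h : IsLimitData x θ g c)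
    (hg : ∀ i, g i < 2 * π) (i : ZMod 4) : g i = gap x i :=
  (arc_eq (h.nonneg i) (hg i) (h.step i)).symm

/-- At a collapsed configuration the limit sum depends only on the limit of one rescaled gap. -/
theorem IsLimitData.limitSum_collapsed {x : ZMod 4 → S1} {θ g c : ZMod 4 → ℝ}
    (h : IsLimitData x θ g c) {k : ZMod 4} (hk : g k = 2 * π) (v : S1 → ℝ → V) :
    limitSum v x g c = sgn k • (v (x 0) (2 * π) - (1 - 2 * c (k + 2)) • v (x 0) 0) := by
  obtain ⟨h1, h2, h3⟩ := h.eq_zero hk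
  obtain ⟨c0, c1⟩ := h.scale k hk
  rw [limitSum, sum_sgn_smul _ k, hk, h1, h2, h3, h.const hk k 0, h.const hk (k + 1) 0,
    h.const hk (k + 2) 0, h.const hk (k + 3) 0, c0]
  have : c (k + 1) = 1 - c (k + 2) - c (k + 3) := by linarith
  rw [this]
  module

/-- Here `a` and `b` are the limit ratios of consecutive small gaps. Eliminating `c1` and `c3`
leaves a linear equation for the middle weight. -/
theorem middle_eq {a b c1 c2 c3 : ℝ} (hs : c1 + c2 + c3 = 1) (h1 : a * (c1 + c2) = c1)
    (h2 : b * (c2 + c3) = c2) : c2 * (1 - a + a * b) = (1 - a) * b := by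
  have e1 : c1 * (1 - a) = a * c2 := by linarith
  have e2 : b * c3 = (1 - b) * c2 := by linarith
  have e3 : c1 = 1 - c2 - c3 := by linarith
  subst e3
  linear_combination (-b) * e1 + (-(1 - a)) * e2

/-- The coefficient in `middle_eq` can vanish only for `a = 1`, `b = 0`, and then the middle weight
is zero. The outer weights need not be determined in that case. -/
theorem middle_unique {a b c1 c2 c3 d1 d2 d3 : ℝ} (hs : c1 + c2 + c3 = 1)
    (h1 : a * (c1 + c2) = c1) (h2 : b * (c2 + c3) = c2) (hs' : d1 + d2 + d3 = 1)
    (h1' : a * (d1 + d2) = d1) (h2' : b * (d2 + d3) = d2) : c2 = d2 := by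
  have e := middle_eq hs h1 h2
  have e' := middle_eq hs' h1' h2'
  by_cases hD : 1 - a + a * b = 0
  · rw [hD, mul_zero, eq_comm, mul_eq_zero] at e
    rcases e with e | e
    · obtain rfl : a = 1 := by linarith
      linarith
    · subst e
      linarith
  · exact mul_right_cancel₀ hD (e.trans e'.symm)

/-- Collapse is visible from the points alone, so two limit data over the same points collapse
together. -/
theorem IsLimitData.exists_collapsed {x : ZMod 4 → S1} {θ g c : ZMod 4 → ℝ}
    (h : IsLimitData x θ g c) (hx : ∀ i j, x i = x j) : ∃ k, g k = 2 * π := by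
  by_contra! hg
  obtain ⟨i, hi⟩ := h.exists_ne fun i => lt_of_le_of_ne (h.le i) (hg i)
  exact hi (hx _ _)

/-- The limit sum depends only on the limits of the points and of the ratios. -/
theorem limitSum_unique {x : ZMod 4 → S1} {θ g c g' c' : ZMod 4 → ℝ} (h : IsLimitData x θ g c)
    (h' : IsLimitData x θ g' c') (v : S1 → ℝ → V) : limitSum v x g c = limitSum v x g' c' := by
  by_cases hk : ∃ k, g k = 2 * π
  · obtain ⟨k, hk⟩ := hk
    obtain ⟨k', hk'⟩ := h'.exists_collapsed (h.const hk)
    rw [h.limitSum_collapsed hk, h'.limitSum_collapsed hk']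
    obtain ⟨-, hs⟩ := h.scale k hk
    obtain ⟨-, hs'⟩ := h'.scale k' hk'
    obtain ⟨t0, t3⟩ := h.ratio_top k hk
    obtain ⟨t0', t3'⟩ := h'.ratio_top k' hk'
    obtain ⟨m1, m2⟩ := h.ratio_mid k hk
    obtain ⟨m1', m2'⟩ := h'.ratio_mid k' hk'
    rcases eq_of_cyclic k k' with rfl | rfl | rfl | rfl
    · rw [middle_unique hs m1 m2 hs' m1' m2']
    -- Long gaps at adjacent places would force the same ratio to be both 1 and 0.
    · rw [add_assoc, show (1 + 3 : ZMod 4) = 0 from rfl, add_zero, t0] at t3'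
      norm_num at t3'
    -- The ratios alternate 1, 0, 1, 0 and do not reveal which of two opposite gaps is the long one.
    -- This is harmless: either way the opposite weight is 1, and `k` and `k + 2` have the same
    -- sign.
    · simp only [add_assoc, show (2 + 3 : ZMod 4) = 1 from rfl, show (2 + 2 : ZMod 4) = 0 from rfl,
        show (2 + 1 : ZMod 4) = 3 from rfl, add_zero] at t3' m1' m2' hs' ⊢
      rw [t3', zero_mul] at m1
      rw [t0', one_mul] at m2
      rw [t3, zero_mul] at m1'
      rw [t0, one_mul] at m2'
      have e : c (k + 2) = 1 := by linarith
      have f : c' k = 1 := by linarith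
      rw [e, f, sgn_add, sgn_two, mul_one (sgn k)]
    · rw [t3] at t0'
      norm_num at t0'
  · push Not at hk
    have hg : ∀ i, g i < 2 * π := fun i => lt_of_le_of_ne (h.le i) (hk i)
    obtain ⟨i, hi⟩ := h.exists_ne hg
    have hg' : ∀ i, g' i < 2 * π := fun j => lt_of_le_of_ne (h'.le j) fun hj =>
      hi (h'.const hj _ _)
    obtain rfl : g = g' := funext fun i => by rw [h.gap_eq hg, h'.gap_eq hg']
    obtain rfl : c = c' := funext fun i => by rw [h.regular hg, h'.regular hg]
    rfl

/-! ### Convergence of gaps and weights along ultrafilters -/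

/-- The folded gaps, rescaled by the arc-length diameter. -/
noncomputable def scaledGap (t : ZMod 4 → S1) (i : ZMod 4) : ℝ :=
  fold (gap t i) / gapDiam (gap t)

theorem scaledGap_mem {t : ZMod 4 → S1} (ht : t ∈ config) (i : ZMod 4) :
    scaledGap t i ∈ Icc (0 : ℝ) 1 :=
  ⟨div_nonneg (fold_nonneg (gap_nonneg _ _) (gap_lt _ _).le) gapDiam_pos.le,
    (div_le_one gapDiam_pos).2 (fold_le_gapDiam (gap_nonneg t) (sum_gap ht) i)⟩

/-- A gap longer than `π` is the largest one. Its fold equals the diameter, and folding leaves the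
other three gaps unchanged, so the weights inherit the relations between gaps and ratios. -/
theorem scaledGap_of_pi_lt {t : ZMod 4 → S1} (ht : t ∈ config) {k : ZMod 4}
    (hk : π < gap t k) :
    (scaledGap t k = 1 ∧ scaledGap t (k + 1) + scaledGap t (k + 2) + scaledGap t (k + 3) = 1) ∧
    ratio t (k + 1) (1, 2) * (scaledGap t (k + 1) + scaledGap t (k + 2)) = scaledGap t (k + 1) ∧
    ratio t (k + 2) (1, 2) * (scaledGap t (k + 2) + scaledGap t (k + 3)) =
      scaledGap t (k + 2) := by
  have hs := gap_cyclic ht k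
  have p1 := gap_pos ht (k + 1)
  have p2 := gap_pos ht (k + 2)
  have p3 := gap_pos ht (k + 3)
  have hd : gapDiam (gap t) = 2 * π - gap t k :=
    gapDiam_eq (forall_cyclic k le_rfl (by linarith) (by linarith) (by linarith))
  have hpos : 0 < 2 * π - gap t k := by linarith
  have f0 : fold (gap t k) = 2 * π - gap t k := min_eq_right (by linarith)
  have f1 : fold (gap t (k + 1)) = gap t (k + 1) := min_eq_left (by linarith)
  have f2 : fold (gap t (k + 2)) = gap t (k + 2) := min_eq_left (by linarith)
  have f3 : fold (gap t (k + 3)) = gap t (k + 3) := min_eq_left (by linarith)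
  have r1 := ratio_one_two ht (k + 1)
  have r2 := ratio_one_two ht (k + 2)
  rw [add_assoc, show (1 + 1 : ZMod 4) = 2 from rfl] at r1
  rw [add_assoc, show (2 + 1 : ZMod 4) = 3 from rfl] at r2
  simp only [scaledGap, hd, f0, f1, f2, f3]
  refine ⟨⟨div_self hpos.ne', ?_⟩, ?_, ?_⟩
  · rw [← add_div, ← add_div, div_eq_one_iff_eq hpos.ne']
    linarith
  · rw [← add_div, ← mul_div_assoc, r1]
  · rw [← add_div, ← mul_div_assoc, r2]

/-- Along an ultrafilter of configurations all gaps and rescaled gaps converge. -/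
theorem exists_isLimitData (U : Ultrafilter (ZMod 4 → S1)) (hU : config ∈ U)
    {x : ZMod 4 → S1} {θ : ZMod 4 → ℝ} (hx : Tendsto id (U : Filter (ZMod 4 → S1)) (𝓝 x))
    (hθ : ∀ i, Tendsto (fun t => ratio t i (1, 2)) (U : Filter (ZMod 4 → S1)) (𝓝 (θ i))) :
    ∃ g c, IsLimitData x θ g c ∧ Tendsto gap (U : Filter (ZMod 4 → S1)) (𝓝 g) ∧
      Tendsto scaledGap (U : Filter (ZMod 4 → S1)) (𝓝 c) := by
  obtain ⟨g, hg, hUg⟩ := (isCompact_univ_pi fun _ : ZMod 4 =>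
    isCompact_Icc (a := (0 : ℝ)) (b := 2 * π)).ultrafilter_le_nhds (U.map gap)
    (le_principal_iff.2 (univ_mem' (f := (U : Filter (ZMod 4 → S1)))
      fun t i _ => ⟨gap_nonneg t i, (gap_lt t i).le⟩))
  obtain ⟨c, hc, hUc⟩ := (isCompact_univ_pi fun _ : ZMod 4 =>
    isCompact_Icc (a := (0 : ℝ)) (b := 1)).ultrafilter_le_nhds (U.map scaledGap)
    (le_principal_iff.2 (mem_of_superset (f := (U : Filter (ZMod 4 → S1))) hU
      fun t ht i _ => scaledGap_mem ht i))
  have hUg : Tendsto gap (U : Filter (ZMod 4 → S1)) (𝓝 g) := hUg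
  have hUc : Tendsto scaledGap (U : Filter (ZMod 4 → S1)) (𝓝 c) := hUc
  have hgi : ∀ i, Tendsto (fun t => gap t i) (U : Filter (ZMod 4 → S1)) (𝓝 (g i)) :=
    tendsto_pi_nhds.1 hUg
  have hci : ∀ i, Tendsto (fun t => scaledGap t i) (U : Filter (ZMod 4 → S1)) (𝓝 (c i)) :=
    tendsto_pi_nhds.1 hUc
  have hxi : ∀ i, Tendsto (fun t : ZMod 4 → S1 => t i) (U : Filter (ZMod 4 → S1)) (𝓝 (x i)) :=
    tendsto_pi_nhds.1 hx
  have hconf : ∀ᶠ t in (U : Filter (ZMod 4 → S1)), t ∈ config := hU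
  -- Near a collapse the long gap eventually exceeds `π`, so the exact relations hold before the
  -- limit is taken.
  have hev : ∀ k, g k = 2 * π → ∀ᶠ t in (U : Filter (ZMod 4 → S1)), t ∈ config ∧ π < gap t k :=
    fun k hk => hconf.and ((hgi k).eventually_const_lt (by linarith [Real.pi_pos]))
  have hsum : ∑ i, g i = 2 * π :=
    tendsto_nhds_unique (tendsto_finsetSum _ fun i _ => hgi i)
      (tendsto_const_nhds.congr' (hconf.mono fun t ht => (sum_gap ht).symm))
  have hrat : ∀ i, θ i * (g i + g (i + 1)) = g i := fun i =>
    tendsto_nhds_unique (((hθ i).mul ((hgi i).add (hgi (i + 1)))).congr'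
      (hconf.mono fun t ht => ratio_one_two ht i)) (hgi i)
  refine ⟨g, c, ⟨fun i => (hg i trivial).1, hsum, fun i => ?_, fun hlt i => ?_,
    fun i => (hc i trivial).1, fun k hk => ⟨?_, ?_⟩, fun k hk => ?_, fun k hk => ⟨?_, ?_⟩⟩,
    hUg, hUc⟩
  · have h1 : Tendsto (fun t => t i + ((gap t i : ℝ) : S1)) (U : Filter (ZMod 4 → S1))
        (𝓝 (x i + ((g i : ℝ) : S1))) :=
      (hxi i).add (((AddCircle.continuous_mk' (2 * π)).tendsto (g i)).comp (hgi i))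
    refine tendsto_nhds_unique h1 ((hxi (i + 1)).congr fun t => (add_gap t i).symm)
  · have hpos : gapDiam g ≠ 0 := by
      obtain ⟨k, hk, -⟩ := exists_gapDiam_eq g
      rw [hk]
      linarith [hlt k]
    exact tendsto_nhds_unique (hci i) (((continuous_fold.tendsto _).comp (hgi i)).div
      ((continuous_gapDiam.tendsto _).comp hUg) hpos)
  · exact tendsto_nhds_unique (hci k) (tendsto_const_nhds.congr'
      ((hev k hk).mono fun t ht => (scaledGap_of_pi_lt ht.1 ht.2).1.1.symm))
  · exact tendsto_nhds_unique (((hci _).add (hci _)).add (hci _)) (tendsto_const_nhds.congr'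
      ((hev k hk).mono fun t ht => (scaledGap_of_pi_lt ht.1 ht.2).1.2.symm))
  · have hs := hsum
    rw [sum_cyclic g k] at hs
    have n1 := (hg (k + 1) trivial).1
    have n2 := (hg (k + 2) trivial).1
    have n3 := (hg (k + 3) trivial).1
    have e1 : g (k + 1) = 0 := by linarith
    have e3 : g (k + 3) = 0 := by linarith
    have r0 := hrat k
    have r3 := hrat (k + 3)
    rw [add_assoc, show (3 + 1 : ZMod 4) = 0 from rfl, add_zero, e3, hk, zero_add] at r3
    rw [e1, hk, add_zero] at r0
    exact ⟨(mul_eq_right₀ Real.two_pi_pos.ne').1 r0,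
      (mul_eq_zero.1 r3).resolve_right Real.two_pi_pos.ne'⟩
  · exact tendsto_nhds_unique (((hθ _).mul ((hci _).add (hci _))).congr'
      ((hev k hk).mono fun t ht => (scaledGap_of_pi_lt ht.1 ht.2).2.1)) (hci _)
  · exact tendsto_nhds_unique (((hθ _).mul ((hci _).add (hci _))).congr'
      ((hev k hk).mono fun t ht => (scaledGap_of_pi_lt ht.1 ht.2).2.2)) (hci _)

/-! ### Points of the boundary -/

variable {R : Set (ℕ × ℕ)}

/-- `arc` is continuous off the diagonal, and `hR` excludes ratios that compare a point with itself.
-/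
theorem continuousAt_graphMap (hR : ∀ p ∈ R, (p.1 : ZMod 4) ≠ 0 ∧ (p.2 : ZMod 4) ≠ 0)
    {t : ZMod 4 → S1} (ht : t ∈ config) : ContinuousAt (graphMap R) t := by
  have harc : ∀ i (a : ZMod 4), a ≠ 0 →
      ContinuousAt (fun t : ZMod 4 → S1 => arc (t i) (t (i + a))) t := fun i a ha =>
    ContinuousAt.comp (f := fun t : ZMod 4 → S1 => (t i, t (i + a))) (x := t)
      (continuousAt_arc fun h => ha (by simpa using ht.1 h)) (by fun_prop)
  refine continuousAt_id.prodMk (continuousAt_pi.2 fun i => continuousAt_pi.2 fun p => ?_)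
  obtain ⟨h1, h2⟩ := hR p p.2
  exact (harc i _ h1).div (harc i _ h2) fun h =>
    h2 (by simpa using ht.1 (arc_eq_zero.1 h))

/-- The identity and `z ↦ graphMap R z.1` agree on the graph, and both converge along it at `y`. -/
theorem eq_graphMap (hR : ∀ p ∈ R, (p.1 : ZMod 4) ≠ 0 ∧ (p.2 : ZMod 4) ≠ 0)
    {y : Ambient R} (hy : y ∈ compactConfig R) (hc : y.1 ∈ config) : y = graphMap R y.1 := by
  have : (𝓝[graphMap R '' config] y).NeBot := mem_closure_iff_nhdsWithin_neBot.1 hy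
  have h1 : Tendsto (fun z : Ambient R => graphMap R z.1) (𝓝[graphMap R '' config] y)
      (𝓝 (graphMap R y.1)) :=
    (continuousAt_graphMap hR hc).tendsto.comp
      ((continuous_fst.tendsto y).mono_left nhdsWithin_le_nhds)
  refine tendsto_nhds_unique (tendsto_id.mono_left nhdsWithin_le_nhds) (h1.congr' ?_)
  filter_upwards [self_mem_nhdsWithin] with z hz
  obtain ⟨t, -, rfl⟩ := hz
  rfl

theorem IsLimitData.mem_config {x : ZMod 4 → S1} {θ g c : ZMod 4 → ℝ} (h : IsLimitData x θ g c)
    (hg : ∀ i, g i ≠ 0) : x ∈ config := by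
  have hp : ∀ i, 0 < g i := fun i => (h.nonneg i).lt_of_ne (hg i).symm
  have hl : ∀ i, g i < 2 * π := fun i => by
    linarith [h.cyclic i, hp (i + 1), hp (i + 2), hp (i + 3)]
  have hne : ∀ i, x i ≠ x (i + 1) := fun i hi => by
    have := h.gap_eq hl i
    rw [gap, arc_eq_zero.2 hi] at this
    exact hg i this
  have hne2 : ∀ i, x i ≠ x (i + 2) := fun i hi => by
    have h1 := h.step i
    have h2 := h.step (i + 1)
    rw [add_assoc, show (1 + 1 : ZMod 4) = 2 from rfl, ← h1, ← hi, add_assoc, add_eq_left,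
      ← AddCircle.coe_add] at h2
    have := coe_eq_coe_imp (add_nonneg (h.nonneg i) (h.nonneg (i + 1)))
      (by linarith [h.cyclic i, hp (i + 2), hp (i + 3)]) le_rfl Real.two_pi_pos (by simpa using h2)
    linarith [hp i, hp (i + 1)]
  refine ⟨fun i j hij => ?_, ?_⟩
  · rcases eq_of_cyclic i j with rfl | rfl | rfl | rfl
    · rfl
    · exact absurd hij (hne i)
    · exact absurd hij (hne2 i)
    · have := hne (i + 3)
      rw [add_assoc, show (3 + 1 : ZMod 4) = 0 from rfl, add_zero] at this
      exact absurd hij.symm this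
  · rw [← h.sum_eq]
    exact Finset.sum_congr rfl fun i _ => (h.gap_eq hl i).symm

/-- The ratios of consecutive points as coordinates on the ambient space. -/
def consecutive (h12 : (1, 2) ∈ R) (y : Ambient R) (i : ZMod 4) : ℝ := y.2 i ⟨(1, 2), h12⟩

/-- A vanishing gap is all that the nonvanishing arguments use about boundary points. -/
theorem exists_eq_zero_of_mem_boundary (h12 : (1, 2) ∈ R)
    (hR : ∀ p ∈ R, (p.1 : ZMod 4) ≠ 0 ∧ (p.2 : ZMod 4) ≠ 0) {y : Ambient R}
    (hy : y ∈ boundary R) {g c : ZMod 4 → ℝ} (h : IsLimitData y.1 (consecutive h12 y) g c) :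
    ∃ j, g j = 0 := by
  by_contra! hg
  exact hy.2 ⟨y.1, h.mem_config hg, (eq_graphMap hR hy.1 (h.mem_config hg)).symm⟩

/-! ### Continuous extension to the compactification -/

/-- The parameter space `S` is a point for a single test map and the unit interval for a homotopy.
-/
theorem exists_tendsto_chordSum (h12 : (1, 2) ∈ R) {S : Type*} [TopologicalSpace S]
    {v : S → S1 → ℝ → V} (hv : Continuous fun q : S × S1 × ℝ => v q.1 q.2.1 q.2.2)
    (s : S) {y : Ambient R} (hy : y ∈ compactConfig R) :
    ∃ g c, IsLimitData y.1 (consecutive h12 y) g c ∧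
      Tendsto (fun z : S × Ambient R => chordSum (v z.1) z.2.1)
        (𝓝[univ ×ˢ (graphMap R '' config)] (s, y)) (𝓝 (limitSum (v s) y.1 g c)) := by
  set A : Set (S × Ambient R) := univ ×ˢ (graphMap R '' config) with hA
  have key : ∀ W : Ultrafilter (S × Ambient R), (W : Filter (S × Ambient R)) ≤ 𝓝[A] (s, y) →
      ∃ g c, IsLimitData y.1 (consecutive h12 y) g c ∧
        Tendsto (fun z : S × Ambient R => chordSum (v z.1) z.2.1)
          (W : Filter (S × Ambient R)) (𝓝 (limitSum (v s) y.1 g c)) := by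
    intro W hW
    have hWy : Tendsto id (W : Filter (S × Ambient R)) (𝓝 (s, y)) := hW.trans nhdsWithin_le_nhds
    have hWA : ∀ᶠ z in (W : Filter (S × Ambient R)), z ∈ A := hW self_mem_nhdsWithin
    have hfst : Tendsto (fun z : S × Ambient R => z.2.1) (W : Filter (S × Ambient R))
        (𝓝 y.1) :=
      ((continuous_fst.comp continuous_snd).tendsto (s, y)).comp hWy
    obtain ⟨g, c, hgc, hg, hc⟩ := exists_isLimitData
      (W.map fun z : S × Ambient R => z.2.1)
      (hWA.mono fun ⟨_, _⟩ hz => by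
        obtain ⟨-, t, ht, rfl⟩ := hz
        exact ht)
      (x := y.1) (θ := consecutive h12 y) (tendsto_map'_iff.2 hfst) fun i => by
        have h1 : Tendsto (fun z : S × Ambient R => consecutive h12 z.2 i)
            (W : Filter (S × Ambient R)) (𝓝 (consecutive h12 y i)) := by
          have hcont : Continuous fun z : S × Ambient R => consecutive h12 z.2 i := by
            unfold consecutive; fun_prop
          exact (hcont.tendsto (s, y)).comp hWy
        refine Tendsto.congr' (f₁ := fun z : S × Ambient R => consecutive h12 z.2 i)
          (f₂ := fun z : S × Ambient R => ratio z.2.1 i (1, 2)) (hWA.mono fun ⟨_, _⟩ hz => ?_) h1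
        obtain ⟨-, t, ht, rfl⟩ := hz
        rfl
    have hg : Tendsto (fun z : S × Ambient R => gap z.2.1) (W : Filter (S × Ambient R)) (𝓝 g) := hg
    have hc : Tendsto (fun z : S × Ambient R => scaledGap z.2.1)
      (W : Filter (S × Ambient R)) (𝓝 c) := hc
    refine ⟨g, c, hgc, tendsto_finsetSum _ fun i _ => Tendsto.const_smul ?_ _⟩
    refine (tendsto_pi_nhds.1 hc i).smul ?_
    have h3 : Tendsto (fun z : S × Ambient R => (z.1, z.2.1 i, gap z.2.1 i))
        (W : Filter (S × Ambient R)) (𝓝 (s, y.1 i, g i)) :=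
      ((continuous_fst.tendsto (s, y)).comp hWy).prodMk_nhds
        ((tendsto_pi_nhds.1 hfst i).prodMk_nhds (tendsto_pi_nhds.1 hg i))
    exact (hv.tendsto (s, y.1 i, g i)).comp h3
  have hne : (𝓝[A] (s, y)).NeBot := by
    rw [← mem_closure_iff_nhdsWithin_neBot, hA, closure_prod_eq, closure_univ]
    exact ⟨trivial, hy⟩
  obtain ⟨g, c, hgc, -⟩ := key (Ultrafilter.of (𝓝[A] (s, y))) (Ultrafilter.of_le _)
  refine ⟨g, c, hgc, (tendsto_iff_ultrafilter _ _ _).2 fun W hW => ?_⟩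
  obtain ⟨g', c', hgc', hlim⟩ := key W hW
  -- All ultrafilters give the same limit, so the filter itself converges.
  rwa [limitSum_unique hgc hgc']

/-- Continuous families of chord sums extend continuously to the compactification. -/
theorem exists_extension (h12 : (1, 2) ∈ R) {S : Type*} [TopologicalSpace S]
    {v : S → S1 → ℝ → V} (hv : Continuous fun q : S × S1 × ℝ => v q.1 q.2.1 q.2.2) :
    ∃ F : C(S × compactConfig R, V),
      (∀ s t (ht : t ∈ config), F (s, ⟨graphMap R t, graphMap_mem R ht⟩) = chordSum (v s) t) ∧
      ∀ s (y : compactConfig R), ∃ g c, IsLimitData y.1.1 (consecutive h12 y.1) g c ∧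
        F (s, y) = limitSum (v s) y.1.1 g c := by
  set A : Set (S × Ambient R) := univ ×ˢ (graphMap R '' config) with hA
  have hcl : univ ×ˢ compactConfig R ⊆ closure A := by
    rw [hA, closure_prod_eq, closure_univ]
    rfl
  have hcont : ContinuousOn (extendFrom A fun z : S × Ambient R => chordSum (v z.1) z.2.1)
      (univ ×ˢ compactConfig R) := continuousOn_extendFrom hcl fun z hz => by
    obtain ⟨g, c, -, h⟩ := exists_tendsto_chordSum h12 hv z.1 hz.2
    exact ⟨_, h⟩
  refine ⟨⟨fun z => extendFrom A (fun z : S × Ambient R => chordSum (v z.1) z.2.1) (z.1, z.2.1),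
    hcont.comp_continuous (by fun_prop) fun z => ⟨trivial, z.2.2⟩⟩, fun s t ht => ?_,
    fun s y => ?_⟩
  · obtain ⟨g, c, -, h⟩ := exists_tendsto_chordSum h12 hv s (graphMap_mem R ht)
    have hmem : (s, graphMap R t) ∈ A := ⟨trivial, t, ht, rfl⟩
    refine (extendFrom_eq (subset_closure hmem) h).trans ?_
    -- At a point of `A` the limit within `A` must be the value there.
    exact (tendsto_nhds_unique ((tendsto_pure_nhds _ _).mono_right le_rfl)
      (h.mono_left (pure_le_nhdsWithin hmem))).symm
  · obtain ⟨g, c, hgc, h⟩ := exists_tendsto_chordSum h12 hv s y.2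
    exact ⟨g, c, hgc, extendFrom_eq (hcl ⟨trivial, y.2⟩) h⟩

/-! ### Equivariance and uniqueness of extensions -/

theorem gap_shift (t : ZMod 4 → S1) (k i : ZMod 4) :
    gap (fun i => t (i + k)) i = gap t (i + k) := by
  simp only [gap, add_right_comm]

theorem gapDiam_shift (g : ZMod 4 → ℝ) (k : ZMod 4) : gapDiam (fun i => g (i + k)) = gapDiam g := by
  obtain ⟨j, hj, hj'⟩ := exists_gapDiam_eq g
  rw [hj, gapDiam_eq (k := j - k)]
  · simp
  · intro i
    simpa using hj' (i + k)

theorem chordSum_shift (v : S1 → ℝ → V) (t : ZMod 4 → S1) (k : ZMod 4) :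
    chordSum v (fun i => t (i + k)) = sgn k • chordSum v t := by
  rw [chordSum, chordSum, ← Equiv.sum_comp (Equiv.addRight k)
    (fun i => sgn i • (fold (gap t i) / gapDiam (gap t)) • v (t i) (gap t i)), Finset.smul_sum]
  refine Finset.sum_congr rfl fun i _ => ?_
  have h : gap (fun i => t (i + k)) = fun i => gap t (i + k) := funext (gap_shift t k)
  have h1 : sgn k * sgn (i + k) = sgn i := by
    rw [sgn_add, mul_left_comm, ← sgn_add, show k + k = k * 2 by ring]
    have : ∀ k : ZMod 4, sgn (k * 2) = 1 := by
      refine forall_cyclic 0 ?_ ?_ ?_ ?_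
      · rw [zero_mul, sgn_zero]
      · rw [zero_add, one_mul, sgn_two]
      · rw [show ((0 + 2) * 2 : ZMod 4) = 0 from rfl, sgn_zero]
      · rw [show ((0 + 3) * 2 : ZMod 4) = 2 from rfl, sgn_two]
    rw [this, mul_one]
  simp only [Equiv.coe_addRight, smul_smul]
  rw [h, gapDiam_shift (gap t) k, ← mul_assoc, h1]

/-- `F` extends the chord sum of `v` from `S¹(4)` to its compactification. -/
def IsChordExtension (v : S1 → ℝ → V) (F : C(compactConfig R, V)) : Prop :=
  ∀ (t : ZMod 4 → S1) (ht : t ∈ config), F ⟨graphMap R t, graphMap_mem R ht⟩ = chordSum v t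

theorem dense_config : Dense {y : compactConfig R | y.1 ∈ graphMap R '' config} := by
  intro y
  rw [closure_subtype]
  have : Subtype.val '' {y : compactConfig R | y.1 ∈ graphMap R '' config} =
      graphMap R '' config := by
    rw [show {y : compactConfig R | y.1 ∈ graphMap R '' config} =
      Subtype.val ⁻¹' (graphMap R '' config) from rfl, Subtype.image_preimage_coe]
    exact inter_eq_right.2 subset_closure
  rw [this]
  exact y.2

omit [NormedSpace ℝ V] in
theorem eq_of_eq_on_config {F G : compactConfig R → V} (hF : Continuous F) (hG : Continuous G)
    (h : ∀ t (ht : t ∈ config), F ⟨graphMap R t, graphMap_mem R ht⟩ =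
      G ⟨graphMap R t, graphMap_mem R ht⟩) : F = G := by
  refine Continuous.ext_on dense_config hF hG fun y hy => ?_
  obtain ⟨y, hy'⟩ := y
  obtain ⟨t, ht, rfl⟩ := hy
  exact h t ht

theorem IsChordExtension.unique {v : S1 → ℝ → V} {F G : C(compactConfig R, V)}
    (hF : IsChordExtension v F) (hG : IsChordExtension v G) : F = G :=
  DFunLike.coe_injective (eq_of_eq_on_config F.continuous G.continuous fun t ht => by
    rw [hF t ht, hG t ht])

theorem IsChordExtension.isEquivariant {v : S1 → ℝ → TestSpace}
    {F : C(compactConfig R, TestSpace)} (hF : IsChordExtension v F) : IsEquivariant F := by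
  intro k
  have hc : Continuous fun y : compactConfig R => k +ᵥ y := by
    refine Continuous.subtype_mk (f := fun y : compactConfig R => shift k y.1) ?_ _
    unfold shift
    fun_prop
  refine congrFun (eq_of_eq_on_config (F.continuous.comp hc)
    (F.continuous.const_smul ((-1 : ℝ) ^ k.val) : Continuous fun y => (-1 : ℝ) ^ k.val • F y)
    fun t ht => ?_)
  have : k +ᵥ (⟨graphMap R t, graphMap_mem R ht⟩ : compactConfig R) =
      ⟨graphMap R fun i => t (i + k), graphMap_mem R (shift_mem_config k ht)⟩ :=
    Subtype.ext (shift_graphMap R k t)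
  simp only [this]
  rw [hF _ (shift_mem_config k ht), hF t ht, chordSum_shift]
  rfl

/-! ### Nonvanishing and equivariant homotopies on the boundary -/

/-- The limits of the chord sums of `v` at the boundary do not vanish. -/
def Admissible (v : S1 → ℝ → V) : Prop :=
  ∀ x θ g c, IsLimitData x θ g c → (∃ j, g j = 0) → limitSum v x g c ≠ 0

theorem exists_isChordExtension (h12 : (1, 2) ∈ R) {v : S1 → ℝ → V}
    (hv : Continuous fun q : S1 × ℝ => v q.1 q.2) :
    ∃ F : C(compactConfig R, V), IsChordExtension v F := by
  obtain ⟨F, hF, -⟩ := exists_extension (R := R) h12 (S := Unit) (v := fun _ => v)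
    (hv.comp continuous_snd)
  exact ⟨F.comp ⟨fun y => ((), y), by fun_prop⟩, fun t ht => hF () t ht⟩

theorem IsChordExtension.ne_zero (h12 : (1, 2) ∈ R)
    (hR : ∀ p ∈ R, (p.1 : ZMod 4) ≠ 0 ∧ (p.2 : ZMod 4) ≠ 0) {v : S1 → ℝ → V}
    (hv : Continuous fun q : S1 × ℝ => v q.1 q.2) (ha : Admissible v)
    {F : C(compactConfig R, V)} (hF : IsChordExtension v F) (y : compactConfig R)
    (hy : y.1 ∈ boundary R) : F y ≠ 0 := by
  obtain ⟨G, hG, hG'⟩ := exists_extension (R := R) h12 (S := Unit) (v := fun _ => v)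
    (hv.comp continuous_snd)
  have : F = G.comp ⟨fun y => ((), y), by fun_prop⟩ := hF.unique fun t ht => hG () t ht
  obtain ⟨g, c, h, h'⟩ := hG' () y
  rw [this]
  exact h' ▸ ha _ _ _ _ h (exists_eq_zero_of_mem_boundary h12 hR hy h)

/-- The boundary maps of the chord sums of `v` and `w` are equivariantly homotopic. -/
def HomotopicBoundary (R : Set (ℕ × ℕ)) (v w : S1 → ℝ → TestSpace) : Prop :=
  ∃ (F G : C(compactConfig R, TestSpace))
    (hF : ∀ y : compactConfig R, (y : Ambient R) ∈ boundary R → F y ≠ 0)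
    (hG : ∀ y : compactConfig R, (y : Ambient R) ∈ boundary R → G y ≠ 0),
    IsChordExtension v F ∧ IsChordExtension w G ∧
    ContinuousMap.HomotopicWith (boundaryMap F hF) (boundaryMap G hG)
      (fun f => IsEquivariant (fun x => (f x : TestSpace)))

theorem HomotopicBoundary.symm {v w : S1 → ℝ → TestSpace} (h : HomotopicBoundary R v w) :
    HomotopicBoundary R w v := by
  obtain ⟨F, G, hF, hG, h1, h2, h3⟩ := h
  exact ⟨G, F, hG, hF, h2, h1, h3.symm⟩

theorem HomotopicBoundary.trans {u v w : S1 → ℝ → TestSpace} (h : HomotopicBoundary R u v)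
    (h' : HomotopicBoundary R v w) : HomotopicBoundary R u w := by
  obtain ⟨F, G, hF, hG, h1, h2, h3⟩ := h
  obtain ⟨G', H, hG', hH, h1', h2', h3'⟩ := h'
  obtain rfl := h2.unique h1'
  exact ⟨F, H, hF, hH, h1, h2', h3.trans h3'⟩

/-- The extension is jointly continuous in the parameter and the point, and each of its time slices
is equivariant as an extension of a chord sum. -/
theorem homotopicBoundary_of_family (h12 : (1, 2) ∈ R)
    (hR : ∀ p ∈ R, (p.1 : ZMod 4) ≠ 0 ∧ (p.2 : ZMod 4) ≠ 0) {v : I → S1 → ℝ → TestSpace}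
    (hv : Continuous fun q : I × S1 × ℝ => v q.1 q.2.1 q.2.2) (ha : ∀ s, Admissible (v s)) :
    HomotopicBoundary R (v 0) (v 1) := by
  obtain ⟨F, hF, hF'⟩ := exists_extension (R := R) h12 hv
  have hne : ∀ s (y : compactConfig R), (y : Ambient R) ∈ boundary R → F (s, y) ≠ 0 := by
    intro s y hy
    obtain ⟨g, c, h, h'⟩ := hF' s y
    rw [h']
    exact ha s _ _ _ _ h (exists_eq_zero_of_mem_boundary h12 hR hy h)
  let slice : I → C(compactConfig R, TestSpace) := fun s => F.comp ⟨fun y => (s, y), by fun_prop⟩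
  have hs : ∀ s, IsChordExtension (v s) (slice s) := fun s t ht => hF s t ht
  refine ⟨slice 0, slice 1, hne 0, hne 1, hs 0, hs 1,
    ⟨⟨⟨⟨fun z => ⟨F (z.1, ⟨z.2.1, z.2.2.1⟩), hne _ _ z.2.2⟩, by fun_prop⟩, ?_, ?_⟩, ?_⟩⟩⟩
  · intro y; rfl
  · intro y; rfl
  · intro s k y
    exact (hs s).isEquivariant k ⟨y.1, y.2.1⟩

/-! ### Chord fields: directions and relative lengths -/

/-- The contribution of a chord with direction `u` and relative length `κ` to a test map. -/
noncomputable def testChord (u : S1 → ℝ → E3) (κ : S1 → ℝ → ℝ) (p : S1) (g : ℝ) : TestSpace :=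
  (-(1 / 2 : ℝ) • u p g, κ p g)

theorem limitSum_testChord (u : S1 → ℝ → E3) (κ : S1 → ℝ → ℝ) (x : ZMod 4 → S1)
    (g c : ZMod 4 → ℝ) :
    limitSum (testChord u κ) x g c = (-(1 / 2 : ℝ) • limitSum u x g c, limitSum κ x g c) := by
  refine Prod.ext ?_ ?_
  · simp only [limitSum, testChord, Prod.fst_sum, Prod.smul_fst, Finset.smul_sum]
    exact Finset.sum_congr rfl fun i _ => by
      rw [smul_comm (c i), smul_comm (sgn i)]
  · simp [limitSum, testChord, Prod.snd_sum]

/-- A nowhere vanishing direction field on the space of chords, odd under exchange of the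
end points, and a positive length function that takes the same value at the two degenerate chords at
each point. -/
structure IsChordField (u : S1 → ℝ → E3) (κ : S1 → ℝ → ℝ) : Prop where
  ne_zero : ∀ p g, 0 ≤ g → g ≤ 2 * π → u p g ≠ 0
  antisymm : ∀ p g, 0 ≤ g → g ≤ 2 * π → u (p + (g : S1)) (2 * π - g) = -u p g
  pos : ∀ p g, 0 ≤ g → g ≤ 2 * π → 0 < κ p g
  symm : ∀ p, κ p (2 * π) = κ p 0

theorem IsChordField.apply_two_pi {u : S1 → ℝ → E3} {κ : S1 → ℝ → ℝ} (h : IsChordField u κ)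
    (p : S1) : u p (2 * π) = -u p 0 := by
  have := h.antisymm p 0 le_rfl Real.two_pi_pos.le
  simpa using this

/-- Direction changes sign between the two degenerate chords at a point and length does not. The two
components are therefore nonzero multiples of `1 - c (k + 2)` and of `c (k + 2)`, which do not
vanish together. -/
theorem IsChordField.limitSum_collapsed_ne_zero {u : S1 → ℝ → E3} {κ : S1 → ℝ → ℝ}
    (h : IsChordField u κ) {x : ZMod 4 → S1} {θ g c : ZMod 4 → ℝ} (hd : IsLimitData x θ g c)
    {k : ZMod 4} (hk : g k = 2 * π) : limitSum (testChord u κ) x g c ≠ 0 := by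
  intro h0
  rw [limitSum_testChord, Prod.mk_eq_zero, hd.limitSum_collapsed hk, hd.limitSum_collapsed hk,
    h.apply_two_pi, h.symm] at h0
  obtain ⟨h1, h2⟩ := h0
  have hκ := h.pos (x 0) 0 le_rfl Real.two_pi_pos.le
  have hu := h.ne_zero (x 0) 0 le_rfl Real.two_pi_pos.le
  have e1 : (sgn k * (1 - c (k + 2))) • u (x 0) 0 = 0 := by
    rw [← h1]
    module
  have e2 : sgn k * (2 * c (k + 2) * κ (x 0) 0) = 0 := by
    simp only [smul_eq_mul] at h2
    linear_combination h2
  have e3 := (mul_eq_zero.1 ((smul_eq_zero.1 e1).resolve_right hu)).resolve_left (sgn_ne_zero k)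
  have e4 := (mul_eq_zero.1 ((mul_eq_zero.1 e2).resolve_left (sgn_ne_zero k))).resolve_right hκ.ne'
  linarith

/-- The zero gap drops out. What remains is a closed triangle of chords, the middle one with the
opposite sign. -/
theorem limitSum_regular (v : S1 → ℝ → V)
    {x : ZMod 4 → S1} {θ g c : ZMod 4 → ℝ} (hd : IsLimitData x θ g c) (hg : ∀ i, g i < 2 * π)
    {j : ZMod 4} (hj : g j = 0) :
    limitSum v x g c = (-sgn j * (gapDiam g)⁻¹) • (fold (g (j + 1)) • v (x (j + 1)) (g (j + 1))
      - fold (g (j + 2)) • v (x (j + 1) + (g (j + 1) : S1)) (g (j + 2))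
      + fold (g (j + 3)) • v (x (j + 1) + (g (j + 1) : S1) + (g (j + 2) : S1)) (g (j + 3))) := by
  have e2 : x (j + 1) + (g (j + 1) : S1) = x (j + 2) := by
    rw [hd.step, add_assoc]; rfl
  have e3 : x (j + 2) + (g (j + 2) : S1) = x (j + 3) := by
    rw [hd.step, add_assoc]; rfl
  rw [limitSum, sum_sgn_smul _ j, hd.regular hg, hd.regular hg, hd.regular hg, hd.regular hg, hj,
    fold_zero, e2, e3]
  simp only [div_eq_mul_inv]
  module

/-- Collapsed limits are nonzero for every chord field, so only the triangles in `hreg` remain to be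
checked. -/
theorem IsChordField.admissible {u : S1 → ℝ → E3} {κ : S1 → ℝ → ℝ} (h : IsChordField u κ)
    (hreg : ∀ p x y z, 0 ≤ x → 0 ≤ y → 0 ≤ z → x < 2 * π → y < 2 * π → z < 2 * π →
      x + y + z = 2 * π →
      fold x • u p x - fold y • u (p + (x : S1)) y + fold z • u (p + (x : S1) + (y : S1)) z = 0 →
      fold x * κ p x - fold y * κ (p + (x : S1)) y + fold z * κ (p + (x : S1) + (y : S1)) z ≠ 0) :
    Admissible (testChord u κ) := by
  intro x θ g c hd ⟨j, hj⟩
  by_cases hk : ∃ k, g k = 2 * π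
  · obtain ⟨k, hk⟩ := hk
    exact h.limitSum_collapsed_ne_zero hd hk
  · push Not at hk
    have hg : ∀ i, g i < 2 * π := fun i => lt_of_le_of_ne (hd.le i) (hk i)
    have hD : gapDiam g ≠ 0 := by
      obtain ⟨k, hk, -⟩ := exists_gapDiam_eq g
      rw [hk]
      linarith [hg k]
    have hs : -sgn j * (gapDiam g)⁻¹ ≠ 0 :=
      mul_ne_zero (neg_ne_zero.2 (sgn_ne_zero j)) (inv_ne_zero hD)
    intro h0
    rw [limitSum_testChord, Prod.mk_eq_zero, limitSum_regular u hd hg hj,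
      limitSum_regular κ hd hg hj] at h0
    have hc := hd.cyclic j
    rw [hj, zero_add] at hc
    refine hreg _ _ _ _ (hd.nonneg (j + 1)) (hd.nonneg (j + 2)) (hd.nonneg (j + 3)) (hg _) (hg _)
      (hg _) hc ?_ ((smul_eq_zero.1 h0.2).resolve_left hs)
    exact (smul_eq_zero.1 ((smul_eq_zero.1 h0.1).resolve_left (by norm_num))).resolve_left hs

/-! ### Round lengths and the two criteria for nonvanishing -/

/-- The relative lengths of the chords of the round circle. -/
noncomputable def roundLength (_ : S1) (g : ℝ) : ℝ := Real.sinc (fold g / 2)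

theorem fold_mul_roundLength (p : S1) (g : ℝ) : fold g * roundLength p g = 2 * sin (g / 2) := by
  have h1 : fold g * roundLength p g = 2 * sin (fold g / 2) := by
    by_cases h : fold g = 0
    · simp [h]
    · rw [roundLength, Real.sinc_of_ne_zero (by simpa using h)]
      field_simp
  rw [h1, fold]
  rcases min_cases g (2 * π - g) with ⟨h, -⟩ | ⟨h, -⟩ <;> rw [h]
  rw [sub_div, mul_div_cancel_left₀ _ (two_ne_zero' ℝ), Real.sin_pi_sub]

theorem roundLength_pos (p : S1) {g : ℝ} (h0 : 0 ≤ g) (h1 : g ≤ 2 * π) : 0 < roundLength p g := by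
  rw [roundLength]
  rcases (fold_nonneg h0 h1).eq_or_lt with h | h
  · rw [← h, zero_div, Real.sinc_zero]
    exact one_pos
  · rw [Real.sinc_of_ne_zero (by positivity)]
    have : fold g ≤ g := min_le_left _ _
    have : fold g ≤ 2 * π - g := min_le_right _ _
    exact div_pos (Real.sin_pos_of_pos_of_lt_pi (by linarith) (by linarith [Real.pi_pos]))
      (by linarith)

theorem roundLength_symm (p : S1) : roundLength p (2 * π) = roundLength p 0 := by
  rw [roundLength, roundLength, ← fold_symm 0, sub_zero]

theorem continuous_roundLength : Continuous fun q : S1 × ℝ => roundLength q.1 q.2 :=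
  Real.continuous_sinc.comp ((continuous_fold.comp continuous_snd).div_const 2)

/-- The strict triangle inequality for the round circle. -/
theorem eq_zero_of_sin_add_sin {a b : ℝ} (ha : 0 ≤ a) (hb : 0 ≤ b) (ha' : a < π) (hb' : b < π)
    (h : sin a + sin b = sin (a + b)) : a = 0 ∨ b = 0 := by
  by_contra! hne
  have h1 := Real.sin_pos_of_pos_of_lt_pi (ha.lt_of_ne hne.1.symm) ha'
  have h2 := Real.sin_pos_of_pos_of_lt_pi (hb.lt_of_ne hne.2.symm) hb'
  have h3 : cos a < 1 := by nlinarith [Real.sin_sq_add_cos_sq a, Real.cos_le_one a]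
  have h4 : cos b < 1 := by nlinarith [Real.sin_sq_add_cos_sq b, Real.cos_le_one b]
  rw [Real.sin_add] at h
  -- The hypothesis reads `sin a * (1 - cos b) + sin b * (1 - cos a) = 0`, a sum of two positive
  -- terms.
  nlinarith [mul_pos h1 (sub_pos.2 h4), mul_pos h2 (sub_pos.2 h3)]

/-- If the length component vanishes, equality in the triangle inequality makes the first or third
side zero. The other two sides are then the same chord traversed in opposite directions, and oddness
of `u` makes their contributions add up instead of cancelling. No relation of `u` to a curve is
needed. -/
theorem admissible_roundLength {u : S1 → ℝ → E3} (h : IsChordField u roundLength) :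
    Admissible (testChord u roundLength) := by
  refine h.admissible fun p x y z hx hy hz hx' hy' hz' hs hu hκ => ?_
  simp only [fold_mul_roundLength] at hκ
  have hsin : sin (y / 2) = sin (x / 2 + z / 2) := by
    rw [← Real.sin_pi_sub]
    congr 1
    linarith
  have key : ∀ w, 0 < w → w < 2 * π → ∀ q, (2 * fold w) • u q w ≠ 0 := fun w h0 h1 q =>
    smul_ne_zero (mul_pos two_pos (fold_pos h0 h1)).ne' (h.ne_zero q w h0.le h1.le)
  rcases eq_zero_of_sin_add_sin (a := x / 2) (b := z / 2) (by linarith) (by linarith)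
    (by linarith) (by linarith) (by linarith) with hx0 | hz0
  · obtain rfl : x = 0 := by linarith
    obtain rfl : z = 2 * π - y := by linarith
    rw [AddCircle.coe_zero, add_zero, h.antisymm p y hy hy'.le, fold_symm, fold_zero] at hu
    refine key y (by linarith) hy' p ?_
    rw [← neg_eq_zero, ← hu]
    module
  · obtain rfl : z = 0 := by linarith
    obtain rfl : y = 2 * π - x := by linarith
    rw [h.antisymm p x hx hx'.le, fold_symm, fold_zero] at hu
    refine key x (by linarith) hx' p ?_
    rw [← hu]
    module

/-- For true chords the alternating sum around a triangle is twice the difference of two vertices.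
Its vanishing makes the middle side zero by injectivity, and the lengths of the other two sides
enter with the same sign. -/
theorem admissible_of_injective {φ : S1 → E3} (hφ : Function.Injective φ) {u : S1 → ℝ → E3}
    {κ : S1 → ℝ → ℝ} (h : IsChordField u κ)
    (hu : ∀ p g, 0 ≤ g → g ≤ 2 * π → fold g • u p g = φ (p + (g : S1)) - φ p) :
    Admissible (testChord u κ) := by
  refine h.admissible fun p x y z hx hy hz hx' hy' hz' hs h0 hκ => ?_
  rw [hu _ _ hx hx'.le, hu _ _ hy hy'.le, hu _ _ hz hz'.le] at h0
  have e : p + (x : S1) + (y : S1) + (z : S1) = p := by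
    rw [add_assoc, add_assoc, ← AddCircle.coe_add, ← AddCircle.coe_add, ← add_assoc, hs,
      coe_two_pi, add_zero]
  rw [e] at h0
  have e1 : (2 : ℝ) • (φ (p + (x : S1)) - φ (p + (x : S1) + (y : S1))) = 0 := by
    rw [← h0]
    module
  have e2 := hφ (sub_eq_zero.1 ((smul_eq_zero.1 e1).resolve_left two_ne_zero))
  rw [left_eq_add] at e2
  obtain rfl : y = 0 := coe_eq_coe_imp hy hy' le_rfl Real.two_pi_pos (by simpa using e2)
  rw [fold_zero] at hκ
  have p1 := mul_pos (fold_pos (by linarith : 0 < x) hx') (h.pos p x hx hx'.le)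
  have p2 := mul_pos (fold_pos (by linarith : 0 < z) hz')
    (h.pos (p + (x : S1) + ((0 : ℝ) : S1)) z hz hz'.le)
  linarith

/-! ### Difference quotients of a `C¹` curve -/

theorem continuous_lift {X : Type*} [TopologicalSpace X] {f : ℝ → X}
    (hf : Function.Periodic f (2 * π)) (hc : Continuous f) :
    Continuous (hf.lift : S1 → X) :=
  isQuotientMap_quotient_mk'.continuous_iff.2 hc

theorem periodic_deriv (φ : S1 → E3) :
    Function.Periodic (deriv fun s : ℝ => φ (s : S1)) (2 * π) := fun s => by
  rw [← deriv_comp_add_const]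
  simp only [AddCircle.coe_add_period]

/-- The derivative of a curve with respect to arc length on the circle. -/
noncomputable def velocity (φ : S1 → E3) : S1 → E3 := (periodic_deriv φ).lift

theorem velocity_coe (φ : S1 → E3) (s : ℝ) :
    velocity φ (s : S1) = deriv (fun s : ℝ => φ (s : S1)) s :=
  (periodic_deriv φ).lift_coe s

/-- The mean velocity of a curve on the arc of length `g` that starts at `p`. -/
noncomputable def meanVelocity (φ : S1 → E3) (p : S1) (g : ℝ) : E3 :=
  ∫ τ in (0 : ℝ)..1, velocity φ (p + ((τ * g : ℝ) : S1))

/-- The difference quotient of a curve for the chord from `p` to `p + g` with respect to the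
arc-length distance. -/
noncomputable def chordDirection (φ : S1 → E3) (p : S1) (g : ℝ) : E3 :=
  if g ≤ π then meanVelocity φ p g else -meanVelocity φ (p + (g : S1)) (2 * π - g)

theorem meanVelocity_zero (φ : S1 → E3) (p : S1) : meanVelocity φ p 0 = velocity φ p := by
  simp [meanVelocity]

theorem add_add_two_pi_sub (p : S1) (g : ℝ) : p + (g : S1) + ((2 * π - g : ℝ) : S1) = p := by
  rw [add_assoc, ← AddCircle.coe_add, add_sub_cancel, coe_two_pi, add_zero]

section

variable {φ : S1 → E3} (hφ : IsC1Embedding φ)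

include hφ

theorem IsC1Embedding.continuous_velocity : Continuous (velocity φ) :=
  continuous_lift _ (hφ.contDiff.continuous_deriv le_rfl)

theorem IsC1Embedding.velocity_ne_zero (p : S1) : velocity φ p ≠ 0 := by
  obtain ⟨s, rfl⟩ := QuotientAddGroup.mk_surjective p
  exact (velocity_coe φ s).trans_ne (hφ.deriv_ne_zero s)

theorem IsC1Embedding.continuous_meanVelocity :
    Continuous fun q : S1 × ℝ => meanVelocity φ q.1 q.2 := by
  refine intervalIntegral.continuous_parametric_intervalIntegral_of_continuous' ?_ 0 1
  refine hφ.continuous_velocity.comp (f := fun q : (S1 × ℝ) × ℝ =>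
    q.1.1 + ((q.2 * q.1.2 : ℝ) : S1)) ?_
  exact (continuous_fst.comp continuous_fst).add ((AddCircle.continuous_mk' (2 * π)).comp
    (continuous_snd.mul (continuous_snd.comp continuous_fst)))

theorem IsC1Embedding.smul_meanVelocity (p : S1) (g : ℝ) :
    g • meanVelocity φ p g = φ (p + (g : S1)) - φ p := by
  obtain ⟨a, rfl⟩ := QuotientAddGroup.mk_surjective p
  have hd : ∀ τ ∈ uIcc (0 : ℝ) 1, HasDerivAt (fun τ : ℝ => φ ((a + τ * g : ℝ) : S1))
      (g • velocity φ ((a + τ * g : ℝ) : S1)) τ := by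
    intro τ _
    have h1 : HasDerivAt (fun s : ℝ => φ (s : S1)) (velocity φ ((a + τ * g : ℝ) : S1))
        (a + τ * g) := by
      rw [velocity_coe]
      exact (hφ.contDiff.differentiable one_ne_zero _).hasDerivAt
    have h2 : HasDerivAt (fun τ : ℝ => a + τ * g) g τ := by
      simpa using ((hasDerivAt_id τ).mul_const g).const_add a
    exact h1.scomp τ h2
  have hc : Continuous fun τ : ℝ => g • velocity φ ((a + τ * g : ℝ) : S1) := by
    refine (hφ.continuous_velocity.comp ((AddCircle.continuous_mk' (2 * π)).comp ?_)).const_smul g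
    fun_prop
  have := intervalIntegral.integral_eq_sub_of_hasDerivAt hd (hc.intervalIntegrable 0 1)
  rw [intervalIntegral.integral_smul] at this
  simpa [meanVelocity] using this

/-- Two complementary half circles have the same chord with opposite orientations. Hence the two
branches of `chordDirection` agree at `g = π`. -/
theorem IsC1Embedding.meanVelocity_pi (p : S1) :
    meanVelocity φ (p + (π : S1)) π = -meanVelocity φ p π := by
  have h1 := hφ.smul_meanVelocity p π
  have h2 := hφ.smul_meanVelocity (p + (π : S1)) π
  have e : p + (π : S1) + (π : S1) = p := by
    rw [add_assoc, ← AddCircle.coe_add, ← two_mul, coe_two_pi, add_zero]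
  rw [e] at h2
  refine smul_right_injective E3 Real.pi_ne_zero ?_
  simp only [smul_neg]
  rw [h1, h2, neg_sub]

theorem IsC1Embedding.continuous_chordDirection :
    Continuous fun q : S1 × ℝ => chordDirection φ q.1 q.2 := by
  refine Continuous.if_le hφ.continuous_meanVelocity ?_ continuous_snd continuous_const ?_
  · refine (hφ.continuous_meanVelocity.comp (f := fun q : S1 × ℝ =>
      (q.1 + (q.2 : S1), 2 * π - q.2)) ?_).neg
    exact (continuous_fst.add ((AddCircle.continuous_mk' (2 * π)).comp continuous_snd)).prodMk
      (by fun_prop)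
  · rintro ⟨p, g⟩ rfl
    rw [show 2 * π - π = π by ring, hφ.meanVelocity_pi, neg_neg]

theorem IsC1Embedding.fold_smul_chordDirection (p : S1) (g : ℝ) :
    fold g • chordDirection φ p g = φ (p + (g : S1)) - φ p := by
  unfold chordDirection fold
  split_ifs with h
  · rw [min_eq_left (by linarith), hφ.smul_meanVelocity]
  · rw [min_eq_right (by linarith), smul_neg, hφ.smul_meanVelocity, add_add_two_pi_sub, neg_sub]

theorem IsC1Embedding.chordDirection_antisymm (p : S1) (g : ℝ) :
    chordDirection φ (p + (g : S1)) (2 * π - g) = -chordDirection φ p g := by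
  unfold chordDirection
  rcases lt_trichotomy g π with h | rfl | h
  · rw [if_neg (by linarith), if_pos h.le, add_add_two_pi_sub, sub_sub_cancel]
  · rw [if_pos (by linarith), if_pos le_rfl, show 2 * π - π = π by ring, hφ.meanVelocity_pi]
  · rw [if_pos (by linarith), if_neg (by linarith), neg_neg]

/-- Injectivity covers the proper chords, and the nonzero velocity covers the degenerate ones. -/
theorem IsC1Embedding.chordDirection_ne_zero (p : S1) {g : ℝ} (h0 : 0 ≤ g) (h1 : g ≤ 2 * π) :
    chordDirection φ p g ≠ 0 := by
  have hz : ∀ p, chordDirection φ p 0 ≠ 0 := fun p => by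
    rw [chordDirection, if_pos Real.pi_pos.le, meanVelocity_zero]
    exact hφ.velocity_ne_zero p
  rcases h0.eq_or_lt with rfl | h0
  · exact hz p
  rcases h1.eq_or_lt with rfl | h1
  · have := hφ.chordDirection_antisymm p 0
    rw [AddCircle.coe_zero, add_zero, sub_zero] at this
    rw [this]
    exact neg_ne_zero.2 (hz p)
  · intro h
    have := hφ.fold_smul_chordDirection p g
    rw [h, smul_zero, eq_comm, sub_eq_zero] at this
    have h2 := hφ.injective this
    rw [add_eq_left] at h2
    exact h0.ne' (coe_eq_coe_imp h0.le h1 le_rfl Real.two_pi_pos (by simpa using h2))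

theorem IsC1Embedding.isChordField {κ : S1 → ℝ → ℝ}
    (hpos : ∀ p g, 0 ≤ g → g ≤ 2 * π → 0 < κ p g) (hsymm : ∀ p, κ p (2 * π) = κ p 0) :
    IsChordField (chordDirection φ) κ :=
  ⟨fun p _ h0 h1 => hφ.chordDirection_ne_zero p h0 h1,
    fun p g _ _ => hφ.chordDirection_antisymm p g, hpos, hsymm⟩

theorem IsC1Embedding.norm_chordDirection_symm (p : S1) :
    ‖chordDirection φ p (2 * π)‖ = ‖chordDirection φ p 0‖ := by
  have := hφ.chordDirection_antisymm p 0
  rw [AddCircle.coe_zero, add_zero, sub_zero] at this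
  rw [this, norm_neg]

/-- The rescaled rhombus test map of a curve is a chord sum. -/
theorem IsC1Embedding.chordSum_eq {t : ZMod 4 → S1} (ht : t ∈ config) :
    chordSum (testChord (chordDirection φ) fun p g => ‖chordDirection φ p g‖) t =
      (arcDiam t)⁻¹ • testMap φ t := by
  have h1 : ∀ i, fold (gap t i) • testChord (chordDirection φ)
      (fun p g => ‖chordDirection φ p g‖) (t i) (gap t i) =
      (-(1 / 2 : ℝ) • (φ (t (i + 1)) - φ (t i)), ‖φ (t i) - φ (t (i + 1))‖) := by
    intro i
    have h2 := hφ.fold_smul_chordDirection (t i) (gap t i)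
    rw [add_gap] at h2
    rw [testChord, Prod.smul_mk, smul_comm, h2, norm_sub_rev, ← h2, norm_smul, smul_eq_mul,
      Real.norm_of_nonneg (fold_nonneg (gap_nonneg _ _) (gap_lt _ _).le)]
  have h2 : chordSum (testChord (chordDirection φ) fun p g => ‖chordDirection φ p g‖) t =
      (arcDiam t)⁻¹ • ∑ i, sgn i •
        (((-(1 / 2 : ℝ) • (φ (t (i + 1)) - φ (t i)), ‖φ (t i) - φ (t (i + 1))‖)) : TestSpace) := by
    rw [chordSum, Finset.smul_sum, arcDiam_eq ht]
    refine Finset.sum_congr rfl fun i _ => ?_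
    rw [← h1 i, div_eq_inv_mul, mul_smul, smul_comm]
  rw [h2, sum_sgn_smul _ 0, sgn_zero, one_smul, testMap, rhombusTest]
  simp only [zero_add, show (1 + 1 : ZMod 4) = 2 from rfl, show (2 + 1 : ZMod 4) = 3 from rfl,
    show (3 + 1 : ZMod 4) = 0 from rfl]
  congr 1
  refine Prod.ext ?_ rfl
  simp only [Prod.fst_sub, Prod.fst_add]
  module

end

/-! ### Deformation of the test map of a curve to an odd loop -/

theorem continuous_testChord {S : Type*} [TopologicalSpace S] {u : S → S1 → ℝ → E3}
    {κ : S → S1 → ℝ → ℝ} (hu : Continuous fun q : S × S1 × ℝ => u q.1 q.2.1 q.2.2)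
    (hκ : Continuous fun q : S × S1 × ℝ => κ q.1 q.2.1 q.2.2) :
    Continuous fun q : S × S1 × ℝ => testChord (u q.1) (κ q.1) q.2.1 q.2.2 :=
  (hu.const_smul (-(1 / 2 : ℝ))).prodMk hκ

/-- A positive combination of positive numbers is positive. -/
theorem lineMap_pos (s : I) {a b : ℝ} (ha : 0 < a) (hb : 0 < b) : 0 < (1 - s : ℝ) * a + s * b :=
  (convex_Ioi (0 : ℝ)) ha hb (sub_nonneg.2 s.2.2) s.2.1 (by ring)

/-- The length part of the test map of a curve can be replaced by that of the round circle. -/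
theorem IsC1Embedding.homotopic_roundLength (h12 : (1, 2) ∈ R)
    (hR : ∀ p ∈ R, (p.1 : ZMod 4) ≠ 0 ∧ (p.2 : ZMod 4) ≠ 0) {φ : S1 → E3} (hφ : IsC1Embedding φ) :
    HomotopicBoundary R (testChord (chordDirection φ) fun p g => ‖chordDirection φ p g‖)
      (testChord (chordDirection φ) roundLength) := by
  have hpos : ∀ (s : I) p g, 0 ≤ g → g ≤ 2 * π →
      0 < (1 - s : ℝ) * ‖chordDirection φ p g‖ + s * roundLength p g := fun s p g h0 h1 =>
    lineMap_pos s (norm_pos_iff.2 (hφ.chordDirection_ne_zero p h0 h1)) (roundLength_pos p h0 h1)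
  have hu : Continuous fun q : I × S1 × ℝ => chordDirection φ q.2.1 q.2.2 :=
    hφ.continuous_chordDirection.comp continuous_snd
  have hr : Continuous fun q : I × S1 × ℝ => roundLength q.2.1 q.2.2 :=
    continuous_roundLength.comp continuous_snd
  have := homotopicBoundary_of_family h12 hR (v := fun s => testChord (chordDirection φ) fun p g =>
      (1 - s : ℝ) * ‖chordDirection φ p g‖ + s * roundLength p g)
    (continuous_testChord (u := fun _ => chordDirection φ) (κ := fun (s : I) p g =>
      (1 - s : ℝ) * ‖chordDirection φ p g‖ + s * roundLength p g) hu (by fun_prop))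
    fun s => admissible_of_injective hφ.injective (hφ.isChordField (hpos s) fun p => by
      rw [hφ.norm_chordDirection_symm, roundLength_symm])
      fun p g _ _ => hφ.fold_smul_chordDirection p g
  simpa using this

/-- The direction field that assigns to a chord the value of a loop at the midpoint of its arc. -/
noncomputable def midpointField (c : S1 → E3) (p : S1) (g : ℝ) : E3 := c (p + ((g / 2 : ℝ) : S1))

/-- Reversing a chord replaces its arc by the complementary one, whose midpoint is antipodal.
Oddness of the loop is thus the antisymmetry of the field. -/
theorem isChordField_midpointField {c : S1 → E3} (h0 : ∀ m, c m ≠ 0)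
    (hodd : ∀ m, c (m + (π : S1)) = -c m) : IsChordField (midpointField c) roundLength where
  ne_zero _ _ _ _ := h0 _
  antisymm p g _ _ := by
    rw [midpointField, midpointField, ← hodd, add_assoc, add_assoc, ← AddCircle.coe_add,
      ← AddCircle.coe_add]
    congr 3
    ring
  pos p _ h0 h1 := roundLength_pos p h0 h1
  symm := roundLength_symm

/-- The chord between the points at distance `π / 2` from `m`. -/
noncomputable def diameterLoop (φ : S1 → E3) (m : S1) : E3 :=
  chordDirection φ (m - ((π / 2 : ℝ) : S1)) π

theorem IsC1Embedding.continuous_diameterLoop {φ : S1 → E3} (hφ : IsC1Embedding φ) :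
    Continuous (diameterLoop φ) :=
  hφ.continuous_chordDirection.comp (f := fun m : S1 => (m - ((π / 2 : ℝ) : S1), π))
    (by fun_prop)

theorem IsC1Embedding.diameterLoop_ne_zero {φ : S1 → E3} (hφ : IsC1Embedding φ) (m : S1) :
    diameterLoop φ m ≠ 0 :=
  hφ.chordDirection_ne_zero _ Real.pi_pos.le (by linarith [Real.pi_pos])

theorem IsC1Embedding.diameterLoop_odd {φ : S1 → E3} (hφ : IsC1Embedding φ) (m : S1) :
    diameterLoop φ (m + (π : S1)) = -diameterLoop φ m := by
  rw [diameterLoop, diameterLoop, ← hφ.chordDirection_antisymm, add_sub_right_comm]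
  congr 1
  ring

/-- The chords of a curve can be shrunk to or expanded to half circles without moving the midpoint
of the arc. -/
theorem IsC1Embedding.homotopic_midpointField (h12 : (1, 2) ∈ R)
    (hR : ∀ p ∈ R, (p.1 : ZMod 4) ≠ 0 ∧ (p.2 : ZMod 4) ≠ 0) {φ : S1 → E3} (hφ : IsC1Embedding φ) :
    HomotopicBoundary R (testChord (chordDirection φ) roundLength)
      (testChord (midpointField (diameterLoop φ)) roundLength) := by
  -- At time `s` the arc has length `(1 - s) * g + s * π` and keeps its midpoint `p + g / 2`.
  set u : I → S1 → ℝ → E3 := fun s p g =>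
    chordDirection φ (p + ((s / 2 * (g - π) : ℝ) : S1)) (π + (1 - s) * (g - π)) with hu
  have hcont : Continuous fun q : I × S1 × ℝ => u q.1 q.2.1 q.2.2 := by
    refine hφ.continuous_chordDirection.comp (f := fun q : I × S1 × ℝ =>
      (q.2.1 + ((q.1 / 2 * (q.2.2 - π) : ℝ) : S1), π + (1 - q.1 : ℝ) * (q.2.2 - π))) ?_
    refine Continuous.prodMk ((continuous_fst.comp continuous_snd).add
      ((AddCircle.continuous_mk' (2 * π)).comp ?_)) ?_ <;> fun_prop
  have hfield : ∀ s, IsChordField (u s) roundLength := by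
    intro s
    have h0 := s.2.1
    have h1 := s.2.2
    refine ⟨fun p g hg hg' => hφ.chordDirection_ne_zero _ ?_ ?_, fun p g _ _ => ?_,
      fun p g h0 h1 => roundLength_pos p h0 h1, roundLength_symm⟩
    · nlinarith [mul_nonneg (sub_nonneg.2 h1) hg, mul_nonneg h0 Real.pi_pos.le]
    · nlinarith [mul_nonneg (sub_nonneg.2 h1) (sub_nonneg.2 hg'), mul_nonneg h0 Real.pi_pos.le]
    · simp only [hu]
      rw [← hφ.chordDirection_antisymm]
      congr 1
      · rw [add_assoc, add_assoc, ← AddCircle.coe_add, ← AddCircle.coe_add]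
        congr 2
        ring
      · ring
  have := homotopicBoundary_of_family h12 hR (v := fun s => testChord (u s) roundLength)
    (continuous_testChord (κ := fun _ => roundLength) hcont (continuous_roundLength.comp continuous_snd))
    fun s => admissible_roundLength (hfield s)
  have e0 : u 0 = chordDirection φ := by
    funext p g
    simp [hu]
  have e1 : u 1 = midpointField (diameterLoop φ) := by
    funext p g
    simp only [hu, midpointField, diameterLoop, Set.Icc.coe_one, sub_self, zero_mul, add_zero]
    congr 1
    rw [add_sub_assoc, ← AddCircle.coe_sub]
    congr 2
    ring
  rwa [e0, e1] at this

/-- Odd loops that are nowhere antiparallel are linearly homotopic. -/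
theorem homotopic_midpointField_of_ne_smul (h12 : (1, 2) ∈ R)
    (hR : ∀ p ∈ R, (p.1 : ZMod 4) ≠ 0 ∧ (p.2 : ZMod 4) ≠ 0) {c w : S1 → E3} (hc : Continuous c)
    (hw : Continuous w) (h0 : ∀ m, c m ≠ 0) (hne : ∀ m (r : ℝ), w m ≠ r • c m)
    (hodd : ∀ m, c (m + (π : S1)) = -c m) (hodd' : ∀ m, w (m + (π : S1)) = -w m) :
    HomotopicBoundary R (testChord (midpointField c) roundLength)
      (testChord (midpointField w) roundLength) := by
  have hm : Continuous fun q : I × S1 × ℝ => q.2.1 + ((q.2.2 / 2 : ℝ) : S1) :=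
    (continuous_fst.comp continuous_snd).add ((AddCircle.continuous_mk' (2 * π)).comp
      (by fun_prop))
  have hu : Continuous fun q : I × S1 × ℝ => (1 - q.1 : ℝ) • c (q.2.1 + ((q.2.2 / 2 : ℝ) : S1)) +
      (q.1 : ℝ) • w (q.2.1 + ((q.2.2 / 2 : ℝ) : S1)) := by
    have h1 := hc.comp hm
    have h2 := hw.comp hm
    simp only [Function.comp_def] at h1 h2
    fun_prop
  have := homotopicBoundary_of_family h12 hR (v := fun s =>
      testChord (midpointField fun m => (1 - s : ℝ) • c m + (s : ℝ) • w m) roundLength)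
    (continuous_testChord (u := fun s : I => midpointField fun m => (1 - s : ℝ) • c m + (s : ℝ) • w m)
      (κ := fun _ => roundLength) hu (continuous_roundLength.comp continuous_snd))
    fun s => admissible_roundLength (isChordField_midpointField (fun m h => ?_) fun m => by
      rw [hodd, hodd']
      module)
  · simpa using this
  · by_cases hs : (s : ℝ) = 0
    · rw [hs, zero_smul, add_zero, sub_zero, one_smul] at h
      exact h0 m h
    -- A zero of the segment at time `s ≠ 0` means `w m = -((1 - s) / s) • c m`.
    · refine hne m (-((s : ℝ)⁻¹ * (1 - s))) ?_
      rw [neg_smul, mul_smul, ← smul_neg, ← eq_neg_of_add_eq_zero_right h, smul_smul,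
        inv_mul_cancel₀ hs, one_smul]

/-! ### A common loop in general position -/

/-- A generic trigonometric loop of degree one is nowhere parallel to two given `C¹` curves. -/
theorem exists_trigonometric_loop {c d : ℝ → E3} (hc : ContDiff ℝ 1 c) (hd : ContDiff ℝ 1 d) :
    ∃ a b : E3, ∀ m r : ℝ, cos m • a + sin m • b ≠ r • c m ∧ cos m • a + sin m • b ≠ r • d m := by
  -- Rotating the pair `(a, b)` by the angle `m` gives `cos m • a + sin m • b` and a free second
  -- vector. The bad pairs have first vector `r • c m`, and `f c` rotates these back: its parameters
  -- are `m`, `r` and the free vector.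
  let f : (ℝ → E3) → ℝ × ℝ × E3 → E3 × E3 := fun c q =>
    (cos q.1 • q.2.1 • c q.1 - sin q.1 • q.2.2, sin q.1 • q.2.1 • c q.1 + cos q.1 • q.2.2)
  have hf : ∀ c : ℝ → E3, ContDiff ℝ 1 c → ContDiff ℝ 1 (f c) := by
    intro c hc
    have hc' : ContDiff ℝ 1 fun q : ℝ × ℝ × E3 => c q.1 := hc.comp contDiff_fst
    fun_prop
  have hdim : ∀ c : ℝ → E3, ContDiff ℝ 1 c → dimH (range (f c)) < Module.finrank ℝ (E3 × E3) := by
    intro c hc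
    -- The source has dimension 5 and the target has dimension 6.
    refine (hf c hc).dimH_range_le.trans_lt ?_
    simp only [Module.finrank_prod, Module.finrank_self, finrank_euclideanSpace_fin]
    norm_num
  have hunion : dimH (range (f c) ∪ range (f d)) < Module.finrank ℝ (E3 × E3) := by
    rw [dimH_union]
    exact max_lt (hdim c hc) (hdim d hd)
  obtain ⟨⟨a, b⟩, hab⟩ := (dense_compl_of_dimH_lt_finrank hunion).nonempty
  have key : ∀ (c : ℝ → E3) (m r : ℝ), cos m • a + sin m • b = r • c m → (a, b) ∈ range (f c) := by
    intro c m r h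
    refine ⟨(m, r, -sin m • a + cos m • b), Prod.ext ?_ ?_⟩
    · simp only [f]
      rw [← h]
      trans (sin m ^ 2 + cos m ^ 2) • a
      · module
      · rw [Real.sin_sq_add_cos_sq, one_smul]
    · simp only [f]
      rw [← h]
      trans (sin m ^ 2 + cos m ^ 2) • b
      · module
      · rw [Real.sin_sq_add_cos_sq, one_smul]
  exact ⟨a, b, fun m r => ⟨fun h => hab (Or.inl (key c m r h)), fun h => hab (Or.inr (key d m r h))⟩⟩

/-- On half circles the difference quotient is the difference of opposite points divided by `π`. Its
`C¹` regularity is what the dimension count needs. -/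
theorem IsC1Embedding.contDiff_diameterLoop {φ : S1 → E3} (hφ : IsC1Embedding φ) :
    ContDiff ℝ 1 fun s : ℝ => diameterLoop φ (s : S1) := by
  have e : (fun s : ℝ => diameterLoop φ (s : S1)) = fun s : ℝ =>
      π⁻¹ • (φ ((s + π / 2 : ℝ) : S1) - φ ((s - π / 2 : ℝ) : S1)) := by
    funext s
    have h := hφ.fold_smul_chordDirection ((s : S1) - ((π / 2 : ℝ) : S1)) π
    have hf : fold π = π := min_eq_left (by linarith [Real.pi_pos])
    rw [hf, sub_add, ← AddCircle.coe_sub, ← AddCircle.coe_sub, ← AddCircle.coe_sub] at h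
    rw [diameterLoop, ← AddCircle.coe_sub, eq_inv_smul_iff₀ Real.pi_ne_zero, h]
    congr 3
    ring
  rw [e]
  have h1 := hφ.contDiff.comp (contDiff_id.add (contDiff_const (c := π / 2)))
  have h2 := hφ.contDiff.comp (contDiff_id.sub (contDiff_const (c := π / 2)))
  exact (h1.sub h2).const_smul _

/-- Sine and cosine change sign under a half turn, so the generic trigonometric loop is odd.
Avoiding both diameter loops at once makes it a common end point for the two deformations. -/
theorem exists_common_loop {φ ψ : S1 → E3} (hφ : IsC1Embedding φ) (hψ : IsC1Embedding ψ) :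
    ∃ w : S1 → E3, Continuous w ∧ (∀ m, w (m + (π : S1)) = -w m) ∧
      (∀ m (r : ℝ), w m ≠ r • diameterLoop φ m) ∧ ∀ m (r : ℝ), w m ≠ r • diameterLoop ψ m := by
  obtain ⟨a, b, hab⟩ := exists_trigonometric_loop hφ.contDiff_diameterLoop hψ.contDiff_diameterLoop
  have hp : Function.Periodic (fun m : ℝ => cos m • a + sin m • b) (2 * π) := fun m => by
    simp only [Real.cos_add_two_pi, Real.sin_add_two_pi]
  refine ⟨hp.lift, continuous_lift hp (by fun_prop), fun m => ?_, fun m r => ?_, fun m r => ?_⟩ <;>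
    obtain ⟨m, rfl⟩ := QuotientAddGroup.mk_surjective m
  · change hp.lift ((m + π : ℝ) : S1) = -hp.lift (m : S1)
    rw [hp.lift_coe, hp.lift_coe, Real.cos_add_pi, Real.sin_add_pi]
    module
  · exact (hab m r).1
  · exact (hab m r).2

/-- The boundary maps of two curves are homotopic. -/
theorem homotopicBoundary_of_curves (h12 : (1, 2) ∈ R)
    (hR : ∀ p ∈ R, (p.1 : ZMod 4) ≠ 0 ∧ (p.2 : ZMod 4) ≠ 0) {φ ψ : S1 → E3}
    (hφ : IsC1Embedding φ) (hψ : IsC1Embedding ψ) :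
    HomotopicBoundary R (testChord (chordDirection φ) fun p g => ‖chordDirection φ p g‖)
      (testChord (chordDirection ψ) fun p g => ‖chordDirection ψ p g‖) := by
  obtain ⟨w, hw, hodd, hwφ, hwψ⟩ := exists_common_loop hφ hψ
  have key : ∀ {χ : S1 → E3}, IsC1Embedding χ → (∀ m (r : ℝ), w m ≠ r • diameterLoop χ m) →
      HomotopicBoundary R (testChord (chordDirection χ) fun p g => ‖chordDirection χ p g‖)
        (testChord (midpointField w) roundLength) := fun hχ hne =>
    ((hχ.homotopic_roundLength h12 hR).trans (hχ.homotopic_midpointField h12 hR)).trans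
      (homotopic_midpointField_of_ne_smul h12 hR hχ.continuous_diameterLoop hw
        hχ.diameterLoop_ne_zero hne hχ.diameterLoop_odd hodd)
  exact (key hφ hwφ).trans (key hψ hwψ).symm

theorem isExtension_iff {φ : S1 → E3} (hφ : IsC1Embedding φ) (F : C(compactConfig R, TestSpace)) :
    IsExtension φ F ↔
      IsChordExtension (testChord (chordDirection φ) fun p g => ‖chordDirection φ p g‖) F := by
  refine forall₂_congr fun t ht => ?_
  rw [hφ.chordSum_eq ht]

theorem IsC1Embedding.continuous_testChord {φ : S1 → E3} (hφ : IsC1Embedding φ) :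
    Continuous fun q : S1 × ℝ =>
      testChord (chordDirection φ) (fun p g => ‖chordDirection φ p g‖) q.1 q.2 :=
  (hφ.continuous_chordDirection.const_smul (-(1 / 2 : ℝ))).prodMk hφ.continuous_chordDirection.norm

theorem IsC1Embedding.admissible {φ : S1 → E3} (hφ : IsC1Embedding φ) :
    Admissible (testChord (chordDirection φ) fun p g => ‖chordDirection φ p g‖) :=
  admissible_of_injective hφ.injective (hφ.isChordField
    (fun p _ h0 h1 => norm_pos_iff.2 (hφ.chordDirection_ne_zero p h0 h1))
    hφ.norm_chordDirection_symm) fun p g _ _ => hφ.fold_smul_chordDirection p g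

end RhombusPeg

theorem mainTheorem4 (R : Set (ℕ × ℕ))
    (hR : R = RhombusPeg.allRatios ∨ R = RhombusPeg.consecutiveRatios) :
    (∀ φ : RhombusPeg.S1 → RhombusPeg.E3, RhombusPeg.IsC1Embedding φ →
      (∃! F : C(RhombusPeg.compactConfig R, RhombusPeg.TestSpace), RhombusPeg.IsExtension φ F) ∧
      ∀ F : C(RhombusPeg.compactConfig R, RhombusPeg.TestSpace), RhombusPeg.IsExtension φ F →
        RhombusPeg.IsEquivariant F ∧
        ∀ x : RhombusPeg.compactConfig R,
          (x : RhombusPeg.Ambient R) ∈ RhombusPeg.boundary R → F x ≠ 0) ∧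
    (∀ φ₀ φ₁ : RhombusPeg.S1 → RhombusPeg.E3,
      RhombusPeg.IsC1Embedding φ₀ → RhombusPeg.IsC1Embedding φ₁ →
      ∀ F₀ F₁ : C(RhombusPeg.compactConfig R, RhombusPeg.TestSpace),
        RhombusPeg.IsExtension φ₀ F₀ → RhombusPeg.IsExtension φ₁ F₁ →
        ∀ (h₀ : ∀ x : RhombusPeg.compactConfig R,
            (x : RhombusPeg.Ambient R) ∈ RhombusPeg.boundary R → F₀ x ≠ 0)
          (h₁ : ∀ x : RhombusPeg.compactConfig R,
            (x : RhombusPeg.Ambient R) ∈ RhombusPeg.boundary R → F₁ x ≠ 0),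
          ContinuousMap.HomotopicWith
            (RhombusPeg.boundaryMap F₀ h₀) (RhombusPeg.boundaryMap F₁ h₁)
            (fun f => RhombusPeg.IsEquivariant (fun x => (f x : RhombusPeg.TestSpace)))) := by
  have h12 : (1, 2) ∈ R := by
    rcases hR with rfl | rfl <;> simp [RhombusPeg.allRatios, RhombusPeg.consecutiveRatios]
  have hR' : ∀ p ∈ R, (p.1 : ZMod 4) ≠ 0 ∧ (p.2 : ZMod 4) ≠ 0 := by
    have h : ∀ p ∈ RhombusPeg.allRatios, (p.1 : ZMod 4) ≠ 0 ∧ (p.2 : ZMod 4) ≠ 0 := by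
      rintro p (rfl | rfl | rfl) <;> decide
    rcases hR with rfl | rfl
    · exact h
    · rintro p rfl
      exact h _ (Or.inl rfl)
  refine ⟨fun φ hφ => ⟨?_, fun F hF => ?_⟩, fun φ ψ hφ hψ F G hF hG h₀ h₁ => ?_⟩
  · obtain ⟨F, hF⟩ := RhombusPeg.exists_isChordExtension h12 hφ.continuous_testChord
    exact ⟨F, (RhombusPeg.isExtension_iff hφ F).2 hF, fun G hG =>
      ((RhombusPeg.isExtension_iff hφ G).1 hG).unique hF⟩
  · rw [RhombusPeg.isExtension_iff hφ] at hF
    exact ⟨hF.isEquivariant, hF.ne_zero h12 hR' hφ.continuous_testChord hφ.admissible⟩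
  · rw [RhombusPeg.isExtension_iff hφ] at hF
    rw [RhombusPeg.isExtension_iff hψ] at hG
    obtain ⟨F', G', hF', hG', h1, h2, h⟩ :=
      RhombusPeg.homotopicBoundary_of_curves h12 hR' hφ hψ
    obtain rfl := hF.unique h1
    obtain rfl := hG.unique h2
    exact h
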